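/- Let $M\subset\mathbb{R}^p\times\mathbb{R}^q$ be open, let $I\subset\mathbb{R}$ be an open set containing $0$, and fix an integer $n\ge 0$. A differential function $F[u,\varepsilon]$ is a smooth function of $(x,u^{(k)},\varepsilon)$ for some finite $k$, with $(x,u)\in M$ and $\varepsilon\in I$, where $u^{(k)}$ collects the jet coordinates $u^\alpha_J$, $|J|\le k$. Let $\mathscr{A}$ be the algebra of differential functions, and write $F\approx G$ if, at every jet over $M$, $F-G=o(\varepsilon^n)$ as $\varepsilon\to0$; two operators on $\mathscr{A}^q$ are $\approx$ if their values on every $Q\in\mathscr{A}^q$ are. Let $D_J$ denote total derivatives and $(-D)_J=(-1)^{|J|}D_J$. Functionals $\mathscr{P}=\int P\,dx$, $P\in\mathscr{A}$, are taken modulo total divergences, and $\int P\,dx\approx0$ means $P\approx\sum_iD_iX_i$ for some $X_i\in\mathscr{A}$. The variational derivative is $(\delta\mathscr{P})_\alpha=\sum_J(-D)_J\,\partial P/\partial u^\alpha_J$. Let $\mathscr{D}$ be a $q\times q$ matrix differential operator with entries $\mathscr{D}_{\alpha\beta}=\sum_J P^{J}_{\alpha\beta}D_J$ (finite sums, $P^J_{\alpha\beta}\in\mathscr{A}$)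 that is approximately Hamiltonian: the bracket $\{\mathscr{P},\mathscr{L}\}=\int\delta\mathscr{P}\cdot\mathscr{D}\,\delta\mathscr{L}\,dx$ satisfies, for all functionals $\mathscr{P},\mathscr{L},\mathscr{R}$, $$\{\mathscr{P},\mathscr{L}\}+\{\mathscr{L},\mathscr{P}\}\approx0,\qquad \{\{\mathscr{P},\mathscr{L}\},\mathscr{R}\}+\{\{\mathscr{L},\mathscr{R}\},\mathscr{P}\}+\{\{\mathscr{R},\mathscr{P}\},\mathscr{L}\}\approx0 .$$ Let $u_t=K\approx\mathscr{D}\,\delta\mathscr{H}$ be an approximate Hamiltonian system of evolution equations, where $K\in\mathscr{A}^q$ and $\mathscr{H}=\int H\,dx$ with $H\in\mathscr{A}$. Let $\hat{\mathbf v}_{\mathscr{H}}$ be the evolutionary vector field with characteristic $Q=\mathscr{D}\,\delta\mathscr{H}$, whose prolongation is $\mathbf{pr}\,\hat{\mathbf v}_{\mathscr{H}}=\sum_{\alpha,J}(D_JQ_\alpha)\,\partial/\partial u^\alpha_J$, and let $\mathbf{pr}\,\hat{\mathbf v}_{\mathscr{H}}(\mathscr{D})$ be the operator with coefficients $\mathbf{pr}\,\hat{\mathbf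 v}_{\mathscr{H}}(P^J_{\alpha\beta})$. Let $\mathbf{D}_K$ be the Fréchet derivative of $K$, $(\mathbf{D}_K)_{\alpha\beta}=\sum_J\frac{\partial K_\alpha}{\partial u^\beta_J}D_J$, and $\mathbf{D}_K^*$ its formal adjoint, $(\mathbf{D}_K^*)_{\alpha\beta}=\sum_J(-D)_J\cdot\frac{\partial K_\beta}{\partial u^\alpha_J}$. Then $$\mathbf{pr}\,\hat{\mathbf v}_{\mathscr{H}}(\mathscr{D})\approx\mathbf{D}_K\cdot\mathscr{D}+\mathscr{D}\cdot\mathbf{D}_K^{*}.$$ -/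

import Mathlib

open scoped ContDiff Topology

noncomputable section

namespace ApproxHam

/-- Multi-indices: `J i` is the number of differentiations with respect to `x^i`. -/
abbrev MultiIndex (p : ℕ) : Type := Fin p → ℕ

/-- Points `(x, (u^α_J))` of the infinite jet space over `ℝ^p × ℝ^q`. -/
abbrev Jet (p q : ℕ) : Type := (Fin p → ℝ) × (Fin q → MultiIndex p → ℝ)

/-- Real functions `F(z, ε)` of a jet `z` and the parameter `ε`. -/
abbrev JetFun (p q : ℕ) : Type := Jet p q → ℝ → ℝ

/-- `q`-tuples of functions of a jet and the parameter. -/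
abbrev JetTuple (p q : ℕ) : Type := Fin q → JetFun p q

/-- The finitely many multi-indices of order at most `k`. -/
def multiIndices (p k : ℕ) : Finset (MultiIndex p) :=
  (Fintype.piFinset fun _ => Finset.range (k + 1)).filter fun J => ∑ i, J i ≤ k

theorem mem_multiIndices {p k : ℕ} {J : MultiIndex p} :
    J ∈ multiIndices p k ↔ ∑ i, J i ≤ k := by
  simp only [multiIndices, Finset.mem_filter, Fintype.mem_piFinset, Finset.mem_range,
    and_iff_right_iff_imp]
  intro h i
  have := Finset.single_le_sum (f := J) (fun _ _ => Nat.zero_le _) (Finset.mem_univ i)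
  omega

theorem zero_mem_multiIndices (p k : ℕ) : (0 : MultiIndex p) ∈ multiIndices p k := by
  simp [mem_multiIndices]

/-- The coordinates `(x, u^(k), ε)`: the `k`-jet together with the parameter. -/
abbrev FinJet (p q k : ℕ) : Type := (Fin p → ℝ) × (Fin q → multiIndices p k → ℝ) × ℝ

/-- The jets lying over `M ⊆ X × U`. -/
def jetsOver {p q : ℕ} (M : Set ((Fin p → ℝ) × (Fin q → ℝ))) : Set (Jet p q) :=
  {z | (z.1, fun α => z.2 α 0) ∈ M}

/-- The points `(x, u^(k), ε)` with `(x, u) ∈ M` and `ε ∈ I`. -/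
def finJetsOver {p q : ℕ} (M : Set ((Fin p → ℝ) × (Fin q → ℝ))) (I : Set ℝ) (k : ℕ) :
    Set (FinJet p q k) :=
  {y | (y.1, fun α => y.2.1 α ⟨0, zero_mem_multiIndices p k⟩) ∈ M ∧ y.2.2 ∈ I}

/-- `F[u, ε]` is a differential function over `M` with parameter `ε ∈ I`: over `M`, it is a smooth
function of `(x, u^(k), ε)` for some finite order `k`. Values off `M` or off `I` are irrelevant. -/
def IsDiffFun {p q : ℕ} (M : Set ((Fin p → ℝ) × (Fin q → ℝ))) (I : Set ℝ) (F : JetFun p q) :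
    Prop :=
  ∃ (k : ℕ) (f : FinJet p q k → ℝ), ContDiffOn ℝ ∞ f (finJetsOver M I k) ∧
    ∀ z ∈ jetsOver M, ∀ ε ∈ I, F z ε = f (z.1, fun α J => z.2 α J, ε)

/-- `q`-tuples of differential functions. -/
def IsDiffTuple {p q : ℕ} (M : Set ((Fin p → ℝ) × (Fin q → ℝ))) (I : Set ℝ)
    (Q : JetTuple p q) : Prop :=
  ∀ α, IsDiffFun M I (Q α)

/-- The partial derivative `∂F/∂x^i`. -/
def partialX {p q : ℕ} (i : Fin p) (F : JetFun p q) : JetFun p q := fun z ε =>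
  deriv (fun s : ℝ => F (Function.update z.1 i s, z.2) ε) (z.1 i)

/-- The partial derivative `∂F/∂u^α_J`. -/
def partialU {p q : ℕ} (α : Fin q) (J : MultiIndex p) (F : JetFun p q) : JetFun p q := fun z ε =>
  deriv (fun s : ℝ => F (z.1, Function.update z.2 α (Function.update (z.2 α) J s)) ε) (z.2 α J)

/-- The total derivative `D_i F = ∂F/∂x^i + ∑_{α,J} u^α_{J,i} ∂F/∂u^α_J`. -/
def totalD {p q : ℕ} (i : Fin p) (F : JetFun p q) : JetFun p q := fun z ε =>
  partialX i F z ε + ∑ α, ∑ᶠ J : MultiIndex p, z.2 α (J + Pi.single i 1) * partialU α J F z ε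

/-- The iterated total derivative `D_J = D_1^{J_1} ⋯ D_p^{J_p}`. -/
def multiD {p q : ℕ} (J : MultiIndex p) (F : JetFun p q) : JetFun p q :=
  (List.finRange p).foldr (fun i G => (totalD i)^[J i] G) F

/-- The sign `(-1)^{|J|}`. -/
def multiSign {p : ℕ} (J : MultiIndex p) : ℝ := (-1) ^ (∑ i, J i)

/-- The total divergence `Div X = ∑_i D_i X_i`. -/
def totalDiv {p q : ℕ} (X : Fin p → JetFun p q) : JetFun p q := fun z ε =>
  ∑ i, totalD i (X i) z ε

/-- The prolonged evolutionary vector field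
`pr v_Q (F) = ∑_{α,J} (D_J Q_α) ∂F/∂u^α_J` with characteristic `Q`. -/
def prolong {p q : ℕ} (Q : JetTuple p q) (F : JetFun p q) : JetFun p q := fun z ε =>
  ∑ α, ∑ᶠ J : MultiIndex p, multiD J (Q α) z ε * partialU α J F z ε

/-- The Euler operator (variational derivative) `E_α(L) = ∑_J (-D)_J ∂L/∂u^α_J`;
this is `δ𝓛` for the functional `𝓛 = ∫ L dx`. -/
def euler {p q : ℕ} (L : JetFun p q) : JetTuple p q := fun α z ε =>
  ∑ᶠ J : MultiIndex p, multiSign J * multiD J (partialU α J L) z ε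

/-- Matrix differential operators, given by their coefficients: `D α β J` is the coefficient
of `D_J` in the entry `(α, β)`. -/
abbrev DiffOp (p q : ℕ) : Type := Fin q → Fin q → MultiIndex p → JetFun p q

/-- The coefficients are differential functions, and only finitely many are nonzero over `M`. -/
def IsDiffOp {p q : ℕ} (M : Set ((Fin p → ℝ) × (Fin q → ℝ))) (I : Set ℝ) (D : DiffOp p q) :
    Prop :=
  (∀ α β J, IsDiffFun M I (D α β J)) ∧
    ∃ S : Finset (MultiIndex p), ∀ α β, ∀ J ∉ S, ∀ z ∈ jetsOver M, ∀ ε ∈ I, D α β J z ε = 0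

/-- The action `(D Q)_α = ∑_{β,J} D_{αβ}^J D_J Q_β`. -/
def DiffOp.apply {p q : ℕ} (D : DiffOp p q) (Q : JetTuple p q) : JetTuple p q := fun α z ε =>
  ∑ β, ∑ᶠ J : MultiIndex p, D α β J z ε * multiD J (Q β) z ε

/-- The action of the formal adjoint, obtained by integrating by parts:
`(D^* Q)_α = ∑_{β,J} (-D)_J (D_{βα}^J Q_β)`. -/
def DiffOp.applyAdjoint {p q : ℕ} (D : DiffOp p q) (Q : JetTuple p q) : JetTuple p q :=
  fun α z ε =>
    ∑ β, ∑ᶠ J : MultiIndex p, multiSign J * multiD J (fun w η => D β α J w η * Q β w η) z ε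

/-- `pr v_Q (D)`: the vector field acts on the coefficients of the operator. -/
def DiffOp.prolong {p q : ℕ} (Q : JetTuple p q) (D : DiffOp p q) : DiffOp p q := fun α β J =>
  ApproxHam.prolong Q (D α β J)

/-- The Fréchet derivative of `K` as a differential operator, with entries
`(D_K)_{αβ} = ∑_J (∂K_α/∂u^β_J) D_J`. See `hasDerivAt_frechet`. -/
def frechet {p q : ℕ} (K : JetTuple p q) : DiffOp p q := fun α β J => partialU β J (K α)

/-- `F ≈ G` to order `n`: `F - G = o(ε^n)` as `ε → 0`, at every jet over `M`. -/
def Approx {p q : ℕ} (M : Set ((Fin p → ℝ) × (Fin q → ℝ))) (n : ℕ) (F G : JetFun p q) : Prop :=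
  ∀ z ∈ jetsOver M, (fun ε => F z ε - G z ε) =o[𝓝 (0 : ℝ)] fun ε => ε ^ n

/-- Two tuples agree to order `n`. -/
def TupleApprox {p q : ℕ} (M : Set ((Fin p → ℝ) × (Fin q → ℝ))) (n : ℕ)
    (P Q : JetTuple p q) : Prop :=
  ∀ α, Approx M n (P α) (Q α)

/-- Two operators on tuples of differential functions agree to order `n`. -/
def OpApprox {p q : ℕ} (M : Set ((Fin p → ℝ) × (Fin q → ℝ))) (I : Set ℝ) (n : ℕ)
    (S T : JetTuple p q → JetTuple p q) : Prop :=
  ∀ Q, IsDiffTuple M I Q → TupleApprox M n (S Q) (T Q)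

/-- `∫ F dx ≈ 0` as a functional, that is modulo total divergences:
`F = Div X + o(ε^n)` for some tuple `X` of differential functions. -/
def FunctionalApproxZero {p q : ℕ} (M : Set ((Fin p → ℝ) × (Fin q → ℝ))) (I : Set ℝ) (n : ℕ)
    (F : JetFun p q) : Prop :=
  ∃ X : Fin p → JetFun p q, (∀ i, IsDiffFun M I (X i)) ∧ Approx M n F (totalDiv X)

/-- The density `δ𝓟 · D δ𝓛` of the bracket `{𝓟, 𝓛}` of `𝓟 = ∫ P dx` and `𝓛 = ∫ L dx`. -/
def bracket {p q : ℕ} (D : DiffOp p q) (P L : JetFun p q) : JetFun p q := fun z ε =>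
  ∑ α, euler P α z ε * D.apply (euler L) α z ε

/-- `D` is an approximate Hamiltonian differential operator (to order `n`): its bracket is
skew-symmetric and satisfies the Jacobi identity, up to `o(ε^n)`. -/
structure IsApproxHamiltonian {p q : ℕ} (M : Set ((Fin p → ℝ) × (Fin q → ℝ))) (I : Set ℝ)
    (n : ℕ) (D : DiffOp p q) : Prop where
  isDiffOp : IsDiffOp M I D
  skew : ∀ P L, IsDiffFun M I P → IsDiffFun M I L →
    FunctionalApproxZero M I n fun z ε => bracket D P L z ε + bracket D L P z ε
  jacobi : ∀ P L R, IsDiffFun M I P → IsDiffFun M I L → IsDiffFun M I R →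
    FunctionalApproxZero M I n fun z ε =>
      bracket D (bracket D P L) R z ε + bracket D (bracket D L R) P z ε +
        bracket D (bracket D R P) L z ε

theorem isOpen_finJetsOver {p q : ℕ} {M : Set ((Fin p → ℝ) × (Fin q → ℝ))} {I : Set ℝ}
    (hM : IsOpen M) (hI : IsOpen I) (k : ℕ) : IsOpen (finJetsOver M I k) := by
  unfold finJetsOver
  exact (hM.preimage (f := fun y : FinJet p q k =>
    (y.1, fun α => y.2.1 α ⟨0, zero_mem_multiIndices p k⟩)) (by fun_prop)).inter
      (hI.preimage (f := fun y : FinJet p q k => y.2.2) (by fun_prop))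

/-- The operator `frechet K` is the derivative `d/ds K[u + s Q]` at `s = 0`. -/
theorem hasDerivAt_frechet {p q : ℕ} {M : Set ((Fin p → ℝ) × (Fin q → ℝ))} {I : Set ℝ}
    (hM : IsOpen M) (hI : IsOpen I) {K : JetTuple p q} (hK : IsDiffTuple M I K)
    (Q : JetTuple p q) (α : Fin q) {z : Jet p q} (hz : z ∈ jetsOver M) {ε : ℝ} (hε : ε ∈ I) :
    HasDerivAt (fun s : ℝ => K α (z.1, fun β J => z.2 β J + s * multiD J (Q β) z ε) ε)
      ((frechet K).apply Q α z ε) 0 := by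
  classical
  obtain ⟨k, f, hf, hKf⟩ := hK α
  set y : FinJet p q k := (z.1, fun β J => z.2 β J, ε) with hy
  have hyM : y ∈ finJetsOver M I k := ⟨hz, hε⟩
  have hopen := isOpen_finJetsOver hM hI k
  have hfd : HasFDerivAt f (fderiv ℝ f y) y :=
    ((hf.contDiffAt (hopen.mem_nhds hyM)).differentiableAt (by simp)).hasFDerivAt
  have key : ∀ w : Fin q → MultiIndex p → ℝ,
      HasDerivAt (fun s : ℝ => K α (z.1, fun β J => z.2 β J + s * w β J) ε)
        (fderiv ℝ f y (0, fun β J => w β J, 0)) 0 := by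
    intro w
    have hg : HasDerivAt (fun s : ℝ => y + s • ((0, fun β J => w β J, 0) : FinJet p q k))
        (0, fun β J => w β J, 0) 0 := by
      simpa using ((hasDerivAt_id (0 : ℝ)).smul_const
        ((0, fun β J => w β J, 0) : FinJet p q k)).const_add y
    have hfd' : HasFDerivAt f (fderiv ℝ f y)
        (y + (0 : ℝ) • ((0, fun β J => w β J, 0) : FinJet p q k)) := by simpa using hfd
    have hcomp := hfd'.comp_hasDerivAt (0 : ℝ) hg
    refine hcomp.congr_of_eventuallyEq ?_
    have hmem : ∀ᶠ s : ℝ in 𝓝 0,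
        y + s • ((0, fun β J => w β J, 0) : FinJet p q k) ∈ finJetsOver M I k :=
      hg.continuousAt.eventually (by simpa using hopen.mem_nhds hyM)
    filter_upwards [hmem] with s hs
    have hs' : ((z.1, fun β J => z.2 β J + s * w β J) : Jet p q) ∈ jetsOver M := by
      have := hs.1
      simpa [hy, jetsOver] using this
    rw [hKf _ hs' ε hε]
    simp only [Function.comp, hy]
    congr 1
    ext <;> simp
  have hpart : ∀ (β : Fin q) (J : MultiIndex p), partialU β J (K α) z ε =
      fderiv ℝ f y (0, fun γ L => Pi.single (M := fun _ => MultiIndex p → ℝ) β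
        (Pi.single J 1) γ (L : MultiIndex p), 0) := by
    intro β J
    have h1 := (key (Pi.single β (Pi.single J 1)))
    have h2 : HasDerivAt (fun s : ℝ => s - z.2 β J) 1 (z.2 β J) :=
      (hasDerivAt_id _).sub_const _
    have h1' : HasDerivAt (fun s : ℝ => K α (z.1, fun γ L => z.2 γ L +
        s * (Pi.single β (Pi.single J 1) : Fin q → MultiIndex p → ℝ) γ L) ε)
        (fderiv ℝ f y (0, fun γ L => (Pi.single β (Pi.single J 1) :
          Fin q → MultiIndex p → ℝ) γ L, 0)) (z.2 β J - z.2 β J) := by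
      rw [sub_self]; exact h1
    have h3 := (HasDerivAt.comp (h := fun s : ℝ => s - z.2 β J) (z.2 β J) h1' h2).deriv
    rw [mul_one] at h3
    rw [← h3]
    unfold partialU
    congr 1
    funext s
    simp only [Function.comp]
    congr 2
    funext γ L
    by_cases hγ : γ = β
    · subst hγ
      by_cases hL : L = J
      · subst hL; simp
      · simp [hL]
    · simp [hγ]
  have hval : (frechet K).apply Q α z ε =
      fderiv ℝ f y (0, fun β J => multiD (J : MultiIndex p) (Q β) z ε, 0) := by
    have hdecomp : ((0, fun β J => multiD (J : MultiIndex p) (Q β) z ε, 0) : FinJet p q k) =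
        ∑ β, ∑ J ∈ multiIndices p k, multiD J (Q β) z ε •
          ((0, fun γ L => (Pi.single β (Pi.single J 1) :
          Fin q → MultiIndex p → ℝ) γ L, 0) : FinJet p q k) := by
      ext γ L
      · simp [Prod.fst_sum]
      · simp only [Prod.snd_sum, Prod.fst_sum, Finset.sum_apply, Prod.smul_snd, Prod.smul_fst,
          Pi.smul_apply, smul_eq_mul]
        rw [Finset.sum_eq_single γ, Finset.sum_eq_single (L : MultiIndex p)]
        · simp
        · intro J _ hJ
          simp [hJ.symm]
        · intro h; exact absurd L.2 h
        · intro β _ hβ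
          simp [hβ.symm]
        · simp
      · simp [Prod.snd_sum]
    rw [hdecomp, map_sum]
    unfold DiffOp.apply frechet
    refine Finset.sum_congr rfl fun β _ => ?_
    rw [map_sum, finsum_eq_sum_of_support_subset (s := multiIndices p k)]
    · refine Finset.sum_congr rfl fun J _ => ?_
      rw [map_smul, hpart, smul_eq_mul, mul_comm]
    · intro J hJ
      by_contra hJk
      apply hJ
      have hz0 : ((0, fun γ L => (Pi.single β (Pi.single J 1) :
          Fin q → MultiIndex p → ℝ) γ L, 0) : FinJet p q k) = 0 := by
        ext γ L
        · simp
        · have hLJ : (L : MultiIndex p) ≠ J := fun h => hJk (by simp [← h])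
          by_cases hγ : γ = β
          · subst hγ; simp [hLJ]
          · simp [hγ]
        · simp
      simp only [hpart, hz0, map_zero, zero_mul]
  rw [hval]
  exact key fun β J => multiD J (Q β) z ε

end ApproxHam

end

noncomputable section

namespace ApproxHam

/-! The relation `≈` can be turned into equality. By Taylor expansion a smooth function of ε is
o(ε^n) exactly when its derivatives of order ≤ n vanish at 0 (`isLittleO_pow_iff`). These
derivatives commute with differentiation along jets, so ∂/∂x^i and ∂/∂u^α_J preserve o(ε^n)
(`isLittleO_dirDeriv`) and descend to the ring of differential functions modulo o(ε^n). This
quotient satisfies the axioms of `JetAlgebra`, and it remains to prove an exact identity in any jet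
algebra (`prM_eq`).

There, write δ for the Euler operator, P for the Hamiltonian operator and K = P δH. Skew-symmetry of
the bracket makes P skew-adjoint under the integral (`int_dotProduct_opM_of_skew`), and likewise
every pr v_T (P). Expanding the Jacobi identity, the terms that differentiate some δF cancel because
the Fréchet derivative of δF is self-adjoint (`int_dotProduct_pr_eul`). What is left (`int_jacobi`)
is the cyclic sum of ∫ δF · pr v_{PδH}(P) δG. On the other side, the product rule gives D_K T = pr
v_T(P) δH + P pr v_T(δH). Inserting this into ∫ δF · (D_K P + P D_K^*) δL, the terms with pr v_T(δH)
cancel by self-adjointness, and the others equal ∫ δF · pr v_K(P) δL by the cyclic identity.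

So the two operators agree when applied to δL and integrated against δF. The substitution principle
(`eq_zero_of_int_dotProduct_eul`) removes δF, and `IsDifferential.eq_zero` removes δL: every tuple
of functions of x is a variational derivative, and such tuples determine the coefficients of a
differential operator. -/

/-! ### Multi-indices and signs. -/

theorem MultiIndex.induction {p : ℕ} {C : MultiIndex p → Prop} (zero : C 0)
    (succ : ∀ J i, C J → C (J + Pi.single i 1)) (J : MultiIndex p) : C J := by
  induction h : ∑ i, J i generalizing J with
  | zero =>
    have : J = 0 := by
      funext i
      simpa using (Finset.sum_eq_zero_iff.1 h) i (Finset.mem_univ i)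
    exact this ▸ zero
  | succ m ih =>
    obtain ⟨i, hi⟩ : ∃ i, J i ≠ 0 := by
      by_contra! h0
      simp [h0] at h
    have hJ : (J - Pi.single i 1) + Pi.single i 1 = J := by
      funext j
      by_cases hj : j = i
      · subst hj; simp; omega
      · simp [hj]
    rw [← hJ]
    refine succ _ _ (ih _ ?_)
    rw [← hJ] at h
    simp only [Pi.add_apply, Finset.sum_add_distrib, Finset.sum_pi_single', Finset.mem_univ,
      if_true] at h
    simpa using h

theorem MultiIndex.add_single_sub {p : ℕ} (J : MultiIndex p) (i : Fin p) :
    J + Pi.single i 1 - Pi.single i 1 = J := by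
  funext j
  simp

theorem MultiIndex.sum_add_single {p : ℕ} (J : MultiIndex p) (i : Fin p) :
    ∑ j, (J + Pi.single i 1 : MultiIndex p) j = ∑ j, J j + 1 := by
  simp [Finset.sum_add_distrib]

theorem MultiIndex.sub_single_add {p : ℕ} {J : MultiIndex p} {i : Fin p} (h : J i ≠ 0) :
    J - Pi.single i 1 + Pi.single i 1 = J := by
  funext j
  by_cases hj : j = i
  · subst hj; simp; omega
  · simp [hj]

theorem multiSign_zero {p : ℕ} : multiSign (0 : MultiIndex p) = 1 := by
  simp [multiSign]

theorem multiSign_add_single {p : ℕ} (J : MultiIndex p) (i : Fin p) :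
    multiSign (J + Pi.single i 1) = -multiSign J := by
  rw [multiSign, MultiIndex.sum_add_single, pow_succ, multiSign]
  ring

theorem multiSign_ne_zero {p : ℕ} (J : MultiIndex p) : multiSign J ≠ 0 :=
  pow_ne_zero _ (by norm_num)

/-- Labels `(α, J)` of the jet coordinates `u^α_J`. -/
abbrev JetIndex (p q : ℕ) : Type := Fin q × MultiIndex p

/-- Raise the `i`-th order of differentiation by one. -/
def JetIndex.shift {p q : ℕ} (i : Fin p) (a : JetIndex p q) : JetIndex p q :=
  (a.1, a.2 + Pi.single i 1)

/-- D_J is an ordered product of powers; since the factors commute, one more factor can be pulled to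
the front. -/
theorem prod_map_pow_add_single {ι G : Type*} [Monoid G] [DecidableEq ι] (f : ι → G)
    (hf : ∀ i j, Commute (f i) (f j)) (J : ι → ℕ) (i : ι) (l : List ι) (hl : l.Nodup)
    (hi : i ∈ l) :
    (l.map fun j => f j ^ (J + Pi.single i 1 : ι → ℕ) j).prod =
      f i * (l.map fun j => f j ^ J j).prod := by
  induction l with
  | nil => simp at hi
  | cons j l ih =>
    rw [List.nodup_cons] at hl
    simp only [List.map_cons, List.prod_cons]
    by_cases hji : j = i
    · subst hji
      have : (l.map fun k => f k ^ (J + Pi.single j 1 : ι → ℕ) k) = l.map fun k => f k ^ J k := by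
        refine List.map_congr_left fun k hk => ?_
        have : k ≠ j := fun h => hl.1 (h ▸ hk)
        simp [this]
      rw [this]
      simp [pow_succ', mul_assoc]
    · rw [ih hl.2 (by simpa [Ne.symm hji] using hi)]
      have := ((hf i j).pow_right (J j)).eq
      simp only [Pi.add_apply, Pi.single_apply, hji, if_false, add_zero]
      rw [← mul_assoc, ← this, mul_assoc]

theorem sum_multiIndices_succ {p m : ℕ} {A : Type*} [AddCommMonoid A]
    (j : Fin p) (g : MultiIndex p → A) (hg : ∀ J, J j = 0 → g J = 0) :
    ∑ J ∈ multiIndices p (m + 1), g J = ∑ J ∈ multiIndices p m, g (J + Pi.single j 1) := by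
  symm
  refine Finset.sum_of_injOn (fun J => J + Pi.single j 1) (fun J _ J' _ h => add_right_cancel h)
    ?_ ?_ fun _ _ => rfl
  · intro J hJ
    simp only [Finset.mem_coe, mem_multiIndices] at hJ ⊢
    rw [MultiIndex.sum_add_single]
    omega
  · intro J hJ hJ'
    refine hg J ?_
    by_contra h
    refine hJ' ⟨J - Pi.single j 1, ?_, MultiIndex.sub_single_add h⟩
    rw [← MultiIndex.sub_single_add h, mem_multiIndices, MultiIndex.sum_add_single] at hJ
    simp only [Finset.mem_coe, mem_multiIndices]
    omega

theorem exists_support_subset {p q : ℕ} {C : Type*} [Zero C] (c : JetIndex p q →₀ C) :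
    ∃ m, c.support ⊆ Finset.univ ×ˢ multiIndices p m := by
  refine ⟨c.support.sup fun a => ∑ i, a.2 i, fun a ha => ?_⟩
  rw [Finset.mem_product, mem_multiIndices]
  exact ⟨Finset.mem_univ _, Finset.le_sup (f := fun a : JetIndex p q => ∑ i, a.2 i) ha⟩

/-! ### Jet algebras and vertical vector fields. -/

/-- A commutative algebra with the formal structure of the algebra of differential functions:
commuting derivations `∂/∂x^i` and `∂/∂u^α_J`, each element depending on finitely many `u^α_J`,
together with coordinate elements. -/
structure JetAlgebra (p q : ℕ) (B : Type*) [CommRing B] [Algebra ℝ B] where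
  /-- The derivations `∂/∂x^i`. -/
  X : Fin p → Derivation ℝ B B
  /-- The vertical differential, whose `(α, J)` component is `∂/∂u^α_J`. -/
  d : Derivation ℝ B (JetIndex p q →₀ B)
  /-- The coordinates `x^i`. -/
  x : Fin p → B
  /-- The coordinates `u^α_J`. -/
  u : JetIndex p q → B
  X_x : ∀ i j, X i (x j) = if i = j then 1 else 0
  X_u : ∀ i a, X i (u a) = 0
  d_x : ∀ j, d (x j) = 0
  d_u : ∀ a, d (u a) = Finsupp.single a 1
  X_comm : ∀ i j F, X i (X j F) = X j (X i F)
  d_X : ∀ i F a, d (X i F) a = X i (d F a)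
  d_comm : ∀ F a b, d (d F a) b = d (d F b) a

namespace JetAlgebra

variable {p q : ℕ} {B : Type*} [CommRing B] [Algebra ℝ B] (S : JetAlgebra p q B)

/-- The vertical vector field `∑ w_a ∂/∂u_a`. -/
def vert (w : JetIndex p q → B) : Derivation ℝ B B :=
  (Finsupp.linearCombination B w).compDer S.d

theorem vert_apply (w : JetIndex p q → B) (F : B) :
    S.vert w F = Finsupp.linearCombination B w (S.d F) := rfl

theorem vert_eq_sum (w : JetIndex p q → B) (F : B) {s : Finset (JetIndex p q)}
    (hs : (S.d F).support ⊆ s) : S.vert w F = ∑ a ∈ s, S.d F a * w a := by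
  rw [vert_apply, Finsupp.linearCombination_apply,
    Finsupp.sum_of_support_subset _ hs _ (by simp)]
  simp

theorem vert_u (w : JetIndex p q → B) (a : JetIndex p q) : S.vert w (S.u a) = w a := by
  simp [vert_apply, d_u]

/-- Identities for vertical fields thereby specialise to identities for single partial derivatives.
-/
theorem vert_single_one (a : JetIndex p q) (F : B) : S.vert (Pi.single a 1) F = S.d F a := by
  classical
  rw [vert_apply, Finsupp.linearCombination_apply, Finsupp.sum,
    Finset.sum_eq_single a]
  · simp
  · intro b _ hb; simp [hb]
  · intro h; simp at h; simp [h]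

/-- The second-order terms of the two compositions agree by symmetry of mixed partials, so only the
derivatives of the coefficients survive. -/
theorem vert_vert_sub (w w' : JetIndex p q → B) (F : B) :
    S.vert w (S.vert w' F) - S.vert w' (S.vert w F) =
      S.vert (fun a => S.vert w (w' a) - S.vert w' (w a)) F := by
  classical
  -- One finite set carrying dF and d of each of its components, so that all sums have the same
  -- range.
  let s := (S.d F).support ∪ (S.d F).support.biUnion fun a => (S.d (S.d F a)).support
  have h1 : (S.d F).support ⊆ s := Finset.subset_union_left
  have h2 : ∀ a, (S.d (S.d F a)).support ⊆ s := by
    intro a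
    by_cases ha : S.d F a = 0
    · simp [ha]
    · exact (Finset.subset_biUnion_of_mem (fun a => (S.d (S.d F a)).support)
        (Finsupp.mem_support_iff.2 ha)).trans Finset.subset_union_right
  have key : ∀ v v' : JetIndex p q → B, S.vert v (S.vert v' F) =
      ∑ a ∈ s, S.d F a * S.vert v (v' a) + ∑ a ∈ s, ∑ b ∈ s, v' a * v b * S.d (S.d F a) b := by
    intro v v'
    rw [S.vert_eq_sum v' F h1, map_sum, ← Finset.sum_add_distrib]
    refine Finset.sum_congr rfl fun a _ => ?_
    rw [Derivation.leibniz, S.vert_eq_sum v _ (h2 a), smul_eq_mul, smul_eq_mul, Finset.mul_sum]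
    congr 1
    exact Finset.sum_congr rfl fun b _ => by ring
  rw [key, key, S.vert_eq_sum _ F h1]
  have : ∑ a ∈ s, ∑ b ∈ s, w' a * w b * S.d (S.d F a) b =
      ∑ a ∈ s, ∑ b ∈ s, w a * w' b * S.d (S.d F a) b := by
    rw [Finset.sum_comm]
    exact Finset.sum_congr rfl fun b _ => Finset.sum_congr rfl fun a _ => by
      rw [S.d_comm F a b]; ring
  rw [this]
  simp only [mul_sub, Finset.sum_sub_distrib]
  ring

theorem X_vert (i : Fin p) (w : JetIndex p q → B) (F : B) :
    S.X i (S.vert w F) = S.vert (fun a => S.X i (w a)) F + S.vert w (S.X i F) := by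
  have h2 : (S.d (S.X i F)).support ⊆ (S.d F).support := by
    intro a ha
    rw [Finsupp.mem_support_iff] at ha ⊢
    contrapose! ha
    rw [d_X, ha, map_zero]
  rw [S.vert_eq_sum _ F subset_rfl, S.vert_eq_sum _ F subset_rfl, S.vert_eq_sum _ _ h2, map_sum,
    ← Finset.sum_add_distrib]
  refine Finset.sum_congr rfl fun a _ => ?_
  rw [Derivation.leibniz, d_X, smul_eq_mul, smul_eq_mul]
  ring

/-! ### Total derivatives. -/

/-- The total derivative `D_i`. -/
def totD (i : Fin p) : Derivation ℝ B B := S.X i + S.vert fun a => S.u (a.shift i)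

theorem totD_apply (i : Fin p) (F : B) :
    S.totD i F = S.X i F + S.vert (fun a => S.u (a.shift i)) F := rfl

theorem totD_u (i : Fin p) (a : JetIndex p q) : S.totD i (S.u a) = S.u (a.shift i) := by
  simp [totD_apply, X_u, vert_u]

theorem totD_x (i j : Fin p) : S.totD i (S.x j) = if i = j then 1 else 0 := by
  simp [totD_apply, X_x, vert_apply, d_x]

theorem vert_sub_left (w w' : JetIndex p q → B) (F : B) :
    S.vert (fun a => w a - w' a) F = S.vert w F - S.vert w' F := by
  simp [S.vert_eq_sum _ F subset_rfl, mul_sub]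

/-- This is the commutator of D_i with a vertical field. The shifted term arises because the field
sends the coefficient u_{J+i} of D_i to w_{J+i}. -/
theorem totD_vert (i : Fin p) (w : JetIndex p q → B) (F : B) :
    S.totD i (S.vert w F) = S.vert (fun a => S.totD i (w a)) F + S.vert w (S.totD i F)
      - S.vert (fun a => w (a.shift i)) F := by
  have h := S.vert_vert_sub (fun a => S.u (a.shift i)) w F
  simp only [vert_u, vert_sub_left] at h
  have h3 : S.vert (fun a => S.totD i (w a)) F = S.vert (fun a => S.X i (w a)) F +
      S.vert (fun a => S.vert (fun a => S.u (a.shift i)) (w a)) F := by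
    simp [S.vert_eq_sum _ F subset_rfl, totD_apply, mul_add, Finset.sum_add_distrib]
  rw [h3, totD_apply, totD_apply, X_vert, map_add]
  linear_combination h

/-- By `totD_vert`, the failure to commute is a difference of doubly shifted coordinates, which
vanishes because shifts commute. -/
theorem totD_comm (i j : Fin p) (F : B) : S.totD i (S.totD j F) = S.totD j (S.totD i F) := by
  have hshift : ∀ a : JetIndex p q, (a.shift j).shift i = (a.shift i).shift j := by
    intro a
    simp [JetIndex.shift, add_right_comm]
  have h1 : S.totD i (S.X j F) = S.X j (S.totD i F) := by
    rw [totD_apply, totD_apply, map_add, X_comm, X_vert]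
    have : S.vert (fun a => S.X j (S.u (a.shift i))) F = 0 := by
      simp [S.vert_eq_sum _ F subset_rfl, X_u]
    rw [this, zero_add]
  rw [S.totD_apply j F, map_add, h1, totD_vert]
  simp only [totD_u, hshift]
  rw [S.totD_apply j]
  ring

/-- These are the relations [∂/∂u^α_J, D_i] = ∂/∂u^α_{J-i}, with zero on the right if J_i = 0;
pushing coefficients forward along the shift avoids the case distinction. -/
theorem d_totD (i : Fin p) (F : B) :
    S.d (S.totD i F) = (S.d F).mapRange (S.totD i) (map_zero _) +
      (S.d F).mapDomain (JetIndex.shift i) := by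
  classical
  ext a
  have h := S.totD_vert i (Pi.single a 1) F
  rw [vert_single_one, vert_single_one] at h
  have h0 : S.vert (fun b => S.totD i ((Pi.single a 1 : JetIndex p q → B) b)) F = 0 := by
    rw [S.vert_eq_sum _ F subset_rfl]
    refine Finset.sum_eq_zero fun b _ => ?_
    by_cases hb : b = a
    · subst hb; simp
    · simp [hb]
  have h1 : (S.d F).mapDomain (JetIndex.shift i) a =
      S.vert (fun b => (Pi.single a 1 : JetIndex p q → B) (b.shift i)) F := by
    rw [vert_apply, Finsupp.linearCombination_apply, Finsupp.mapDomain, Finsupp.sum_apply]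
    refine Finsupp.sum_congr fun b _ => ?_
    simp [Finsupp.single_apply, Pi.single_apply]
  rw [Finsupp.add_apply, Finsupp.mapRange_apply, h1]
  linear_combination -h - h0

/-- The iterated total derivative `D_J`. -/
def mD (J : MultiIndex p) : Module.End ℝ B :=
  ((List.finRange p).map fun i => (S.totD i : Module.End ℝ B) ^ J i).prod

theorem mD_zero (F : B) : S.mD 0 F = F := by
  have : S.mD 0 = 1 := by simp [mD]
  rw [this]; rfl

theorem mD_add_single (J : MultiIndex p) (i : Fin p) (F : B) :
    S.mD (J + Pi.single i 1) F = S.totD i (S.mD J F) := by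
  rw [mD, prod_map_pow_add_single (fun i => (S.totD i : Module.End ℝ B)) _ _ _ _
    (List.nodup_finRange p) (List.mem_finRange i)]
  · rfl
  · intro i j
    exact LinearMap.ext fun F => S.totD_comm i j F

theorem totD_mD (J : MultiIndex p) (i : Fin p) (F : B) :
    S.totD i (S.mD J F) = S.mD J (S.totD i F) := by
  induction J using MultiIndex.induction with
  | zero => simp [mD_zero]
  | succ J j ih => rw [mD_add_single, mD_add_single, totD_comm, ih]

/-- Multiplication by x^j acts on operators as a lowering: its commutator with D_J is J_j D_{J-j}.
This makes functions of x sufficient as test functions. -/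
theorem mD_x_mul (J : MultiIndex p) (j : Fin p) (F : B) :
    S.mD J (S.x j * F) = S.x j * S.mD J F + (J j : ℝ) • S.mD (J - Pi.single j 1) F := by
  induction J using MultiIndex.induction with
  | zero => simp [mD_zero]
  | succ J i ih =>
    rw [mD_add_single, ih, mD_add_single, map_add, Derivation.leibniz, Derivation.map_smul, totD_x,
      smul_eq_mul, smul_eq_mul]
    by_cases hij : i = j
    · subst hij
      rw [MultiIndex.add_single_sub]
      -- If J_i = 0, subtraction is truncated, but the factor J_i removes the term.
      by_cases hJ : J i = 0
      · simp [hJ]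
      · rw [← mD_add_single S J, ← mD_add_single S (J - _), MultiIndex.sub_single_add hJ]
        simp [add_smul]
        abel
    · by_cases hJ : J j = 0
      · simp [hJ, hij, Ne.symm hij]
      · have : J + Pi.single i 1 - Pi.single j 1 = J - Pi.single j 1 + Pi.single i 1 := by
          funext k
          by_cases hk : k = j
          · subst hk; simp [Ne.symm hij]
          · simp [hk]
        rw [this, mD_add_single S (J - _)]
        simp [hij, Ne.symm hij]

/-- The signed iterated total derivative `(-D)_J`. -/
def sD (J : MultiIndex p) : Module.End ℝ B := multiSign J • S.mD J

theorem sD_zero (F : B) : S.sD 0 F = F := by simp [sD, multiSign_zero, mD_zero]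

theorem sD_add_single (J : MultiIndex p) (i : Fin p) (F : B) :
    S.sD (J + Pi.single i 1) F = -S.totD i (S.sD J F) := by
  simp [sD, multiSign_add_single, mD_add_single]

theorem totD_sD (J : MultiIndex p) (i : Fin p) (F : B) :
    S.totD i (S.sD J F) = S.sD J (S.totD i F) := by
  simp [sD, totD_mD]

/-! ### Functionals, formal adjoints and the Euler operator. -/

/-- Total divergences. -/
def divs : Submodule ℝ B := ⨆ i, LinearMap.range (S.totD i : B →ₗ[ℝ] B)

theorem totD_mem_divs (i : Fin p) (F : B) : S.totD i F ∈ S.divs :=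
  Submodule.mem_iSup_of_mem i ⟨F, rfl⟩

/-- The functional `∫ F dx`, as the class of `F` modulo total divergences. -/
def int : B →ₗ[ℝ] B ⧸ S.divs := S.divs.mkQ

theorem int_totD (i : Fin p) (F : B) : S.int (S.totD i F) = 0 :=
  (Submodule.Quotient.mk_eq_zero _).2 (S.totD_mem_divs i F)

/-- Integration by parts, one total derivative at a time. -/
theorem int_mul_mD (J : MultiIndex p) (F G : B) :
    S.int (F * S.mD J G) = S.int (S.sD J F * G) := by
  induction J using MultiIndex.induction generalizing F with
  | zero => simp [mD_zero, sD_zero]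
  | succ J i ih =>
    have h := S.int_totD i (F * S.mD J G)
    rw [Derivation.leibniz, map_add, smul_eq_mul, smul_eq_mul, mul_comm (S.mD J G), ih] at h
    rw [mD_add_single, eq_neg_of_add_eq_zero_left h, sD_add_single, totD_sD, neg_mul, map_neg]

/-- The prolongation `(D_J Q_α)` of a tuple. -/
def jp (Q : Fin q → B) (a : JetIndex p q) : B := S.mD a.2 (Q a.1)

/-- The scalar differential operator `Q ↦ ∑ c_{α,J} D_J Q_α`. -/
def op (c : JetIndex p q →₀ B) (Q : Fin q → B) : B := Finsupp.linearCombination B (S.jp Q) c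

/-- The formal adjoint of `op`, with components `∑_J (-D)_J (c_{α,J} R)`. -/
def adj (c : JetIndex p q →₀ B) (R : B) : Fin q → B :=
  c.sum fun a b => Pi.single a.1 (S.sD a.2 (b * R))

theorem adj_add (c c' : JetIndex p q →₀ B) (R : B) :
    S.adj (c + c') R = S.adj c R + S.adj c' R :=
  Finsupp.sum_add_index' (by simp) (by simp [add_mul, Pi.single_add])

theorem adj_single (a : JetIndex p q) (b R : B) :
    S.adj (Finsupp.single a b) R = Pi.single a.1 (S.sD a.2 (b * R)) :=
  Finsupp.sum_single_index (by simp)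

theorem op_add (c c' : JetIndex p q →₀ B) (Q : Fin q → B) :
    S.op (c + c') Q = S.op c Q + S.op c' Q := by simp [op]

theorem op_smul (b : B) (c : JetIndex p q →₀ B) (Q : Fin q → B) :
    S.op (b • c) Q = b * S.op c Q := by simp [op]

theorem op_single (a : JetIndex p q) (b : B) (Q : Fin q → B) :
    S.op (Finsupp.single a b) Q = b * S.mD a.2 (Q a.1) := by simp [op, jp]

theorem int_mul_op (c : JetIndex p q →₀ B) (Q : Fin q → B) (R : B) :
    S.int (R * S.op c Q) = S.int (Q ⬝ᵥ S.adj c R) := by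
  induction c using Finsupp.induction_linear with
  | zero => simp [op, adj]
  | add c c' h h' => rw [op_add, adj_add, mul_add, dotProduct_add, map_add, map_add, h, h']
  | single a b =>
    rw [op_single, adj_single, dotProduct_single, ← mul_assoc, int_mul_mD, mul_comm R b, mul_comm]

/-- The Euler operator. -/
def eul (F : B) : Fin q → B := S.adj (S.d F) 1

theorem eul_add (F G : B) : S.eul (F + G) = S.eul F + S.eul G := by
  rw [eul, map_add, adj_add]; rfl

/-- By `d_totD`, a coefficient c at J contributes (-D)_J D_i c and (-D)_{J+i} c, which are opposite.
-/
theorem eul_totD (i : Fin p) (F : B) : S.eul (S.totD i F) = 0 := by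
  rw [eul, d_totD]
  generalize S.d F = c
  induction c using Finsupp.induction_linear with
  | zero => simp [adj]
  | add c c' h h' =>
    rw [Finsupp.mapRange_add (fun a b => map_add _ a b), Finsupp.mapDomain_add, add_add_add_comm,
      adj_add, h, h', add_zero]
  | single a b =>
    rw [Finsupp.mapRange_single, Finsupp.mapDomain_single, adj_add, adj_single, adj_single,
      JetIndex.shift, mul_one, mul_one, sD_add_single, totD_sD, ← Pi.single_add, add_neg_cancel,
      Pi.single_zero]

theorem eul_eq_zero_of_int {F : B} (h : S.int F = 0) : S.eul F = 0 := by
  let e : B →+ (Fin q → B) := ⟨⟨S.eul, by simp [eul, adj]⟩, S.eul_add⟩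
  rw [int, Submodule.mkQ_apply, Submodule.Quotient.mk_eq_zero] at h
  refine Submodule.iSup_induction (fun i => LinearMap.range (S.totD i : B →ₗ[ℝ] B))
    (motive := fun F => e F = 0) h ?_ (map_zero e) fun F G hF hG => by
      rw [map_add, hF, hG, add_zero]
  rintro i _ ⟨F, rfl⟩
  exact S.eul_totD i F

/-! ### Evolutionary vector fields. -/

/-- The prolonged evolutionary vector field with characteristic `Q`. -/
def pr (Q : Fin q → B) : Derivation ℝ B B := S.vert (S.jp Q)

theorem pr_apply (Q : Fin q → B) (F : B) : S.pr Q F = S.op (S.d F) Q := rfl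

theorem int_pr (Q : Fin q → B) (F : B) : S.int (S.pr Q F) = S.int (Q ⬝ᵥ S.eul F) := by
  rw [pr_apply, eul, ← int_mul_op, one_mul]

/-- The coefficients of a prolongation satisfy w_{J+i} = D_i w_J, so two terms in `totD_vert`
cancel. -/
theorem pr_totD (Q : Fin q → B) (i : Fin p) (F : B) :
    S.pr Q (S.totD i F) = S.totD i (S.pr Q F) := by
  have h : (fun a : JetIndex p q => S.jp Q (a.shift i)) = fun a => S.totD i (S.jp Q a) := by
    funext a
    simp [jp, JetIndex.shift, mD_add_single]
  rw [pr, totD_vert, h]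
  ring

theorem pr_mD (Q : Fin q → B) (J : MultiIndex p) (F : B) :
    S.pr Q (S.mD J F) = S.mD J (S.pr Q F) := by
  induction J using MultiIndex.induction with
  | zero => simp [mD_zero]
  | succ J j ih => rw [mD_add_single, mD_add_single, pr_totD, ih]

/-- Evolutionary fields therefore act on functionals: identities under the integral may be
differentiated along them. -/
theorem int_pr_eq_zero (Q : Fin q → B) {F : B} (h : S.int F = 0) : S.int (S.pr Q F) = 0 := by
  rw [int_pr, eul_eq_zero_of_int _ h, dotProduct_zero, map_zero]

theorem pr_pr_sub (Q R : Fin q → B) (F : B) :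
    S.pr R (S.pr Q F) - S.pr Q (S.pr R F) =
      S.pr (fun α => S.pr R (Q α) - S.pr Q (R α)) F := by
  have h := S.vert_vert_sub (S.jp R) (S.jp Q) F
  have h' : (fun a => S.vert (S.jp R) (S.jp Q a) - S.vert (S.jp Q) (S.jp R a)) =
      S.jp fun α => S.pr R (Q α) - S.pr Q (R α) := by
    funext a
    change S.pr R (S.mD _ _) - S.pr Q (S.mD _ _) = _
    rw [pr_mD, pr_mD, jp, map_sub]
  rw [h'] at h
  exact h

theorem derivation_dotProduct (δ : Derivation ℝ B B) (Q R : Fin q → B) :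
    δ (Q ⬝ᵥ R) = (fun α => δ (Q α)) ⬝ᵥ R + Q ⬝ᵥ fun α => δ (R α) := by
  simp only [dotProduct, map_sum, Derivation.leibniz, ← Finset.sum_add_distrib, smul_eq_mul]
  exact Finset.sum_congr rfl fun α _ => by ring

/-- The Fréchet derivative of a variational derivative is self-adjoint. -/
theorem int_dotProduct_pr_eul (Q R : Fin q → B) (L : B) :
    S.int (Q ⬝ᵥ fun α => S.pr R (S.eul L α)) = S.int (R ⬝ᵥ fun α => S.pr Q (S.eul L α)) := by
  -- Differentiate ∫ pr v_Q(L) = ∫ Q · δL along R.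
  have key : ∀ Q R : Fin q → B, S.int (S.pr R (S.pr Q L)) =
      S.int ((fun α => S.pr R (Q α)) ⬝ᵥ S.eul L) + S.int (Q ⬝ᵥ fun α => S.pr R (S.eul L α)) := by
    intro Q R
    have h : S.int (S.pr Q L - Q ⬝ᵥ S.eul L) = 0 := by rw [map_sub, int_pr, sub_self]
    have h' := S.int_pr_eq_zero R h
    rw [map_sub, map_sub, derivation_dotProduct, sub_eq_zero] at h'
    rw [h', map_add]
  -- The commutator is evolutionary, and its characteristic paired with δL accounts exactly for the
  -- terms in which Q and R are differentiated.
  have h := congrArg S.int (S.pr_pr_sub Q R L)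
  have hs : (fun α => S.pr R (Q α) - S.pr Q (R α)) =
    (fun α => S.pr R (Q α)) - fun α => S.pr Q (R α) := rfl
  rw [map_sub, key, key, int_pr, hs, sub_dotProduct, map_sub] at h
  have := sub_eq_zero.2 h
  rw [← sub_eq_zero, ← this]
  abel

/-! ### Test functions and the substitution principle. -/

/-- The coefficients of an operator that kills all functions of `x` vanish. Here `T J c` stands
for an operator such as `f ↦ c D_J f` or `f ↦ D_J (c f)`. -/
theorem coeff_eq_zero (T : MultiIndex p → B →ₗ[ℝ] B →ₗ[ℝ] B) (hT1 : ∀ c, T 0 c 1 = c)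
    (hTx : ∀ J j c f, T J c (S.x j * f) =
      S.x j * T J c f + (J j : ℝ) • T (J - Pi.single j 1) c f)
    (m : ℕ) (c : MultiIndex p → B)
    (hc : ∀ f, S.d f = 0 → ∑ J ∈ multiIndices p m, T J (c J) f = 0) :
    ∀ J ∈ multiIndices p m, c J = 0 := by
  -- Once all coefficients with J ≠ 0 vanish, the test function 1 gives the remaining one.
  have main : ∀ (m : ℕ) (c : MultiIndex p → B),
      (∀ f, S.d f = 0 → ∑ J ∈ multiIndices p m, T J (c J) f = 0) →
      (∀ J ∈ multiIndices p m, J ≠ 0 → c J = 0) → ∀ J ∈ multiIndices p m, c J = 0 := by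
    intro m c hc hne J hJ
    by_cases h : J = 0
    · subst h
      have := hc 1 (by simp)
      rw [Finset.sum_eq_single_of_mem 0 hJ, hT1] at this
      · exact this
      · intro J hJ h0
        simp [hne J hJ h0]
    · exact hne J hJ h
  induction m generalizing c with
  | zero =>
    refine main 0 c hc fun J hJ h => absurd ?_ h
    rw [mem_multiIndices] at hJ
    funext i
    simpa using (Finset.sum_eq_zero_iff.1 (Nat.le_zero.1 hJ)) i (Finset.mem_univ i)
  | succ m ih =>
    refine main _ c hc fun J hJ h => ?_
    obtain ⟨j, hj⟩ : ∃ j, J j ≠ 0 := by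
      by_contra! h0
      exact h (funext h0)
    -- Replacing f by x^j f and subtracting x^j times the original relation leaves an operator of
    -- lower order with coefficients (J_j + 1) c_{J+j}. Terms with J_j = 0 drop out, which allows
    -- the reindexing.
    have key := ih (fun J => ((J j : ℝ) + 1) • c (J + Pi.single j 1)) (by
      intro f hf
      have h1 := hc (S.x j * f) (by simp [S.d_x, hf])
      simp only [hTx, Finset.sum_add_distrib, ← Finset.mul_sum, hc f hf, mul_zero,
        zero_add] at h1
      rw [sum_multiIndices_succ j _ (by intro J hJ; simp [hJ])] at h1
      rw [← h1]
      refine Finset.sum_congr rfl fun J _ => ?_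
      rw [MultiIndex.add_single_sub]
      simp) (J - Pi.single j 1) (by
      rw [← MultiIndex.sub_single_add hj, mem_multiIndices, MultiIndex.sum_add_single] at hJ
      rw [mem_multiIndices]
      omega)
    rw [MultiIndex.sub_single_add hj] at key
    exact (smul_eq_zero.1 key).resolve_left (by positivity)

theorem op_eq_sum (c : JetIndex p q →₀ B) (Q : Fin q → B) {s : Finset (MultiIndex p)}
    (hs : c.support ⊆ Finset.univ ×ˢ s) :
    S.op c Q = ∑ α, ∑ J ∈ s, c (α, J) * S.mD J (Q α) := by
  rw [op, Finsupp.linearCombination_apply, Finsupp.sum_of_support_subset _ hs _ (by simp),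
    Finset.sum_product]
  rfl

theorem adj_eq_sum (c : JetIndex p q →₀ B) (R : B) (α : Fin q) {s : Finset (MultiIndex p)}
    (hs : c.support ⊆ Finset.univ ×ˢ s) :
    S.adj c R α = ∑ J ∈ s, S.sD J (c (α, J) * R) := by
  rw [adj, Finsupp.sum_of_support_subset _ hs _ (by simp), Finset.sum_product,
    Finset.sum_apply, Finset.sum_eq_single α]
  · simp
  · intro β _ h
    simp [Ne.symm h]
  · simp

theorem eq_zero_of_op_eq_zero {c : JetIndex p q →₀ B}
    (h : ∀ Q, (∀ α, S.d (Q α) = 0) → S.op c Q = 0) : c = 0 := by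
  obtain ⟨m, hm⟩ := exists_support_subset c
  have key : ∀ α, ∀ J ∈ multiIndices p m, c (α, J) = 0 := by
    intro α
    refine S.coeff_eq_zero (fun J => ((LinearMap.mul ℝ B).compl₂ (S.mD J))) (by simp [mD_zero])
      (by simp [mD_x_mul, mul_add, mul_left_comm]) m _ fun f hf => ?_
    have h1 := h (Pi.single α f) (by
      intro β
      by_cases hβ : β = α
      · subst hβ; simpa using hf
      · simp [hβ])
    rw [S.op_eq_sum c _ hm, Finset.sum_eq_single α] at h1
    · simpa using h1
    · intro β _ hβ
      simp [hβ]
    · simp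
  ext a
  by_contra ha
  have := Finset.mem_product.1 (hm (Finsupp.mem_support_iff.2 ha))
  exact ha (key a.1 a.2 this.2)

/-- Here `coeff_eq_zero` is used with T J c f = D_J (c f), so the signs are absorbed into the
coefficients. -/
theorem eq_zero_of_adj_eq_zero {c : JetIndex p q →₀ B}
    (h : ∀ f, S.d f = 0 → S.adj c f = 0) : c = 0 := by
  obtain ⟨m, hm⟩ := exists_support_subset c
  have key : ∀ α, ∀ J ∈ multiIndices p m, multiSign J • c (α, J) = 0 := by
    intro α
    refine S.coeff_eq_zero (fun J => ((LinearMap.mul ℝ B).compr₂ (S.mD J))) (by simp [mD_zero])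
      (fun J j c f => ?_) m _ fun f hf => ?_
    · simp only [LinearMap.compr₂_apply, LinearMap.mul_apply', mul_left_comm c]
      exact S.mD_x_mul J j (c * f)
    · rw [← Pi.zero_apply (M := fun _ => B) α, ← h f hf, S.adj_eq_sum c f α hm]
      simp [sD]
  ext a
  by_contra ha
  have := Finset.mem_product.1 (hm (Finsupp.mem_support_iff.2 ha))
  exact ha ((smul_eq_zero.1 (key a.1 a.2 this.2)).resolve_left (multiSign_ne_zero _))

theorem adj_smul_one (b : B) (c : JetIndex p q →₀ B) : S.adj (b • c) 1 = S.adj c b := by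
  induction c using Finsupp.induction_linear with
  | zero => simp [adj]
  | add c c' h h' => rw [smul_add, adj_add, adj_add, h, h']
  | single a r => rw [Finsupp.smul_single, adj_single, adj_single, smul_eq_mul, mul_one, mul_comm]

/-- **Substitution principle**: a tuple orthogonal to all variational derivatives vanishes. -/
theorem eq_zero_of_int_dotProduct_eul {W : Fin q → B}
    (h : ∀ L, S.int (W ⬝ᵥ S.eul L) = 0) : W = 0 := by
  funext β
  have hd : S.d (W β) = 0 := by
    refine S.eq_zero_of_adj_eq_zero fun f hf => ?_
    -- Since δ(f u^β) = f e_β, the product f W_β is a divergence. Its Euler derivative is the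
    -- adjoint of dW_β applied to f, so W_β cannot depend on u.
    have h1 := h (f * S.u (β, 0))
    rw [eul, Derivation.leibniz, hf, smul_zero, add_zero, d_u, Finsupp.smul_single, adj_single,
      dotProduct_single] at h1
    have h2 := S.eul_eq_zero_of_int h1
    simpa [eul, hf, sD_zero, mul_comm (W β) f, adj_smul_one] using h2
  -- The density (u^β)²/2 has variational derivative u^β e_β; as dW_β = 0, the Euler derivative of
  -- W_β u^β is W_β e_β.
  have h1 := h ((1 / 2 : ℝ) • (S.u (β, 0) * S.u (β, 0)))
  have hdu : S.d ((1 / 2 : ℝ) • (S.u (β, 0) * S.u (β, 0))) =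
      Finsupp.single (β, 0) (S.u (β, 0)) := by
    rw [Derivation.map_smul, Derivation.leibniz, d_u, ← two_smul ℝ, smul_smul]
    simp
  rw [eul, hdu, adj_single, dotProduct_single] at h1
  have h2 := S.eul_eq_zero_of_int h1
  simp only [eul, mul_one, sD_zero, Derivation.leibniz, hd, smul_zero, add_zero, d_u,
    Finsupp.smul_single, adj_single, smul_eq_mul] at h2
  simpa using congrFun h2 β

/-! ### Closure properties of differential operators. -/

/-- Scalar differential operators on tuples. -/
def IsDifferential (Φ : (Fin q → B) → B) : Prop := ∃ c, ∀ Q, Φ Q = S.op c Q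

variable {S}

theorem IsDifferential.add {Φ Ψ : (Fin q → B) → B} (hΦ : S.IsDifferential Φ)
    (hΨ : S.IsDifferential Ψ) : S.IsDifferential fun Q => Φ Q + Ψ Q := by
  obtain ⟨c, hc⟩ := hΦ
  obtain ⟨c', hc'⟩ := hΨ
  exact ⟨c + c', fun Q => by simp only [op_add, hc, hc']⟩

theorem IsDifferential.const_mul {Φ : (Fin q → B) → B} (hΦ : S.IsDifferential Φ) (b : B) :
    S.IsDifferential fun Q => b * Φ Q := by
  obtain ⟨c, hc⟩ := hΦ
  exact ⟨b • c, fun Q => by simp only [op_smul, hc]⟩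

theorem IsDifferential.neg {Φ : (Fin q → B) → B} (hΦ : S.IsDifferential Φ) :
    S.IsDifferential fun Q => -Φ Q := by
  simpa using hΦ.const_mul (-1)

theorem IsDifferential.zero : S.IsDifferential fun _ => 0 := ⟨0, fun Q => by simp [op]⟩

theorem IsDifferential.sum {ι : Type*} {s : Finset ι} {Φ : ι → (Fin q → B) → B}
    (hΦ : ∀ i ∈ s, S.IsDifferential (Φ i)) : S.IsDifferential fun Q => ∑ i ∈ s, Φ i Q := by
  classical
  induction s using Finset.induction_on with
  | empty => simpa using IsDifferential.zero
  | insert i s hi ih =>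
    simp only [Finset.sum_insert hi]
    exact (hΦ i (by simp)).add (ih fun j hj => hΦ j (by simp [hj]))

theorem IsDifferential.coord (α : Fin q) : S.IsDifferential fun Q => Q α :=
  ⟨Finsupp.single (α, 0) 1, fun Q => by simp [op_single, mD_zero]⟩

/-- The coefficients come from D_i (c D_J) = (D_i c) D_J + c D_{J+i}. -/
theorem IsDifferential.totD {Φ : (Fin q → B) → B} (hΦ : S.IsDifferential Φ) (i : Fin p) :
    S.IsDifferential fun Q => S.totD i (Φ Q) := by
  obtain ⟨c, hc⟩ := hΦ
  refine ⟨c.mapRange (S.totD i) (map_zero _) + c.mapDomain (JetIndex.shift i), fun Q => ?_⟩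
  simp only [hc]
  clear hc
  induction c using Finsupp.induction_linear with
  | zero => simp [op]
  | add c c' h h' =>
    rw [Finsupp.mapRange_add (fun a b => map_add _ a b), Finsupp.mapDomain_add, add_add_add_comm,
      op_add, op_add, map_add, h, h']
  | single a b =>
    rw [Finsupp.mapRange_single, Finsupp.mapDomain_single, op_add, op_single, op_single,
      op_single, JetIndex.shift, mD_add_single, Derivation.leibniz, smul_eq_mul, smul_eq_mul]
    ring

theorem IsDifferential.mD {Φ : (Fin q → B) → B} (hΦ : S.IsDifferential Φ) (J : MultiIndex p) :
    S.IsDifferential fun Q => S.mD J (Φ Q) := by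
  induction J using MultiIndex.induction with
  | zero => simpa only [mD_zero] using hΦ
  | succ J i ih => simpa only [mD_add_single] using ih.totD i

theorem IsDifferential.sD {Φ : (Fin q → B) → B} (hΦ : S.IsDifferential Φ) (J : MultiIndex p) :
    S.IsDifferential fun Q => S.sD J (Φ Q) := by
  have := (hΦ.mD J).const_mul (algebraMap ℝ B (multiSign J))
  simpa only [JetAlgebra.sD, LinearMap.smul_apply, ← Algebra.smul_def] using this

theorem IsDifferential.op {Φ : Fin q → (Fin q → B) → B} (hΦ : ∀ α, S.IsDifferential (Φ α))
    (c : JetIndex p q →₀ B) : S.IsDifferential fun Q => S.op c fun α => Φ α Q := by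
  obtain ⟨m, hm⟩ := exists_support_subset c
  simp only [S.op_eq_sum c _ hm]
  exact IsDifferential.sum fun α _ => IsDifferential.sum fun J _ => ((hΦ α).mD J).const_mul _

theorem IsDifferential.adj {Φ : (Fin q → B) → B} (hΦ : S.IsDifferential Φ)
    (c : JetIndex p q →₀ B) (α : Fin q) : S.IsDifferential fun Q => S.adj c (Φ Q) α := by
  obtain ⟨m, hm⟩ := exists_support_subset c
  simp only [S.adj_eq_sum c _ _ hm]
  exact IsDifferential.sum fun J _ => (hΦ.const_mul _).sD J

variable (S)

theorem eul_mul_u {f : B} (hf : S.d f = 0) (β : Fin q) :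
    S.eul (f * S.u (β, 0)) = Pi.single β f := by
  simp [eul, hf, d_u, adj_single, sD_zero]

/-- A differential operator vanishing on all variational derivatives is zero. -/
theorem IsDifferential.eq_zero {Φ : (Fin q → B) → B} (hΦ : S.IsDifferential Φ)
    (h : ∀ L, Φ (S.eul L) = 0) (Q : Fin q → B) : Φ Q = 0 := by
  obtain ⟨c, hc⟩ := hΦ
  have hc0 : c = 0 := by
    refine S.eq_zero_of_op_eq_zero fun Q hQ => ?_
    -- Tuples without u-dependence are variational derivatives of densities linear in u.
    have hL : S.eul (∑ α, Q α * S.u (α, 0)) = Q := by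
      let e : B →+ (Fin q → B) := ⟨⟨S.eul, by simp [eul, JetAlgebra.adj]⟩, S.eul_add⟩
      change e _ = _
      rw [map_sum]
      change ∑ α, S.eul _ = _
      simp only [S.eul_mul_u (hQ _)]
      exact Finset.univ_sum_single Q
    rw [← hc, ← hL, h]
  rw [hc, hc0]
  simp [JetAlgebra.op]

/-! ### Hamiltonian operators in a jet algebra. -/

/-- The action of a matrix differential operator, whose rows are the coefficients of scalar
operators. -/
def opM (P : Fin q → JetIndex p q →₀ B) (Q : Fin q → B) : Fin q → B := fun α => S.op (P α) Q

/-- The formal adjoint of `opM`. -/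
def adjM (P : Fin q → JetIndex p q →₀ B) (R : Fin q → B) : Fin q → B :=
  fun α => ∑ β, S.adj (P β) (R β) α

/-- The prolonged vector field acting on the coefficients of an operator. -/
def prM (R : Fin q → B) (P : Fin q → JetIndex p q →₀ B) : Fin q → JetIndex p q →₀ B :=
  fun α => (P α).mapRange (S.pr R) (map_zero _)

theorem int_dotProduct_opM (P : Fin q → JetIndex p q →₀ B) (Q R : Fin q → B) :
    S.int (R ⬝ᵥ S.opM P Q) = S.int (Q ⬝ᵥ S.adjM P R) := by
  have : Q ⬝ᵥ S.adjM P R = ∑ β, Q ⬝ᵥ S.adj (P β) (R β) := by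
    simp only [dotProduct, adjM, Finset.mul_sum]
    exact Finset.sum_comm
  rw [this, dotProduct, map_sum, map_sum]
  exact Finset.sum_congr rfl fun α _ => S.int_mul_op _ _ _

theorem pr_op (R : Fin q → B) (c : JetIndex p q →₀ B) (Q : Fin q → B) :
    S.pr R (S.op c Q) = S.op (c.mapRange (S.pr R) (map_zero _)) Q +
      S.op c fun α => S.pr R (Q α) := by
  induction c using Finsupp.induction_linear with
  | zero => simp [op]
  | add c c' h h' =>
    rw [Finsupp.mapRange_add (fun a b => map_add _ a b), op_add, op_add, op_add, map_add, h, h']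
    ring
  | single a b =>
    rw [Finsupp.mapRange_single, op_single, op_single, op_single, Derivation.leibniz, pr_mD,
      smul_eq_mul, smul_eq_mul]
    ring

theorem pr_opM (R : Fin q → B) (P : Fin q → JetIndex p q →₀ B) (Q : Fin q → B) :
    (fun α => S.pr R (S.opM P Q α)) = S.opM (S.prM R P) Q + S.opM P fun α => S.pr R (Q α) :=
  funext fun α => S.pr_op R (P α) Q

/-- The bracket density of the operator `P`. -/
def brk (P : Fin q → JetIndex p q →₀ B) (F G : B) : B := S.eul F ⬝ᵥ S.opM P (S.eul G)

variable {S} {P : Fin q → JetIndex p q →₀ B}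

/-- Skew-symmetry of the bracket makes the operator skew-adjoint. -/
theorem int_dotProduct_opM_of_skew (hskew : ∀ F G, S.int (S.brk P F G + S.brk P G F) = 0)
    (Q R : Fin q → B) : S.int (Q ⬝ᵥ S.opM P R) = -S.int (R ⬝ᵥ S.opM P Q) := by
  -- The substitution principle removes the first argument of the bracket; the second is removed in
  -- `h2` by `IsDifferential.eq_zero`.
  have h1 : ∀ L, S.opM P (S.eul L) + S.adjM P (S.eul L) = 0 := by
    intro L
    refine S.eq_zero_of_int_dotProduct_eul fun F => ?_
    have := hskew F L
    rw [brk, brk, map_add, S.int_dotProduct_opM P (S.eul F)] at this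
    rwa [dotProduct_comm, dotProduct_add, map_add]
  have h2 : ∀ Q, S.opM P Q + S.adjM P Q = 0 := by
    intro Q
    funext α
    refine IsDifferential.eq_zero S (Φ := fun Q => S.opM P Q α + S.adjM P Q α) ?_
      (fun L => congrFun (h1 L) α) Q
    exact (IsDifferential.op (fun β => IsDifferential.coord β) _).add
      (IsDifferential.sum fun β _ => (IsDifferential.coord β).adj _ _)
  rw [S.int_dotProduct_opM, eq_neg_of_add_eq_zero_right (h2 Q), dotProduct_neg, map_neg]

/-- Differentiate the skew-adjointness of P along T; the terms in which T acts on Q or R cancel by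
skew-adjointness itself. -/
theorem int_dotProduct_prM_of_skew (hskew : ∀ F G, S.int (S.brk P F G + S.brk P G F) = 0)
    (T Q R : Fin q → B) :
    S.int (Q ⬝ᵥ S.opM (S.prM T P) R) = -S.int (R ⬝ᵥ S.opM (S.prM T P) Q) := by
  have hs := int_dotProduct_opM_of_skew hskew
  have h := S.int_pr_eq_zero T (F := Q ⬝ᵥ S.opM P R + R ⬝ᵥ S.opM P Q) (by
    rw [map_add, hs, neg_add_cancel])
  simp only [map_add, derivation_dotProduct, pr_opM, dotProduct_add] at h
  rw [hs (fun α => S.pr T (Q α)) R, hs (fun α => S.pr T (R α)) Q] at h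
  rw [eq_neg_iff_add_eq_zero, ← h]
  abel

/-- The Jacobi identity in terms of the derivatives of the operator along Hamiltonian vector
fields. -/
theorem int_jacobi (hskew : ∀ F G, S.int (S.brk P F G + S.brk P G F) = 0)
    (hjac : ∀ F G H, S.int (S.brk P (S.brk P F G) H + S.brk P (S.brk P G H) F +
      S.brk P (S.brk P H F) G) = 0) (F G H : B) :
    S.int (S.eul F ⬝ᵥ S.opM (S.prM (S.opM P (S.eul H)) P) (S.eul G)) +
      S.int (S.eul G ⬝ᵥ S.opM (S.prM (S.opM P (S.eul F)) P) (S.eul H)) +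
      S.int (S.eul H ⬝ᵥ S.opM (S.prM (S.opM P (S.eul G)) P) (S.eul F)) = 0 := by
  have hs := int_dotProduct_opM_of_skew hskew
  -- A bracket with H is, under the integral, the derivative along P δH; the product rule and
  -- skew-adjointness do the rest.
  have key : ∀ F G H, S.int (S.brk P (S.brk P F G) H) =
      S.int (S.opM P (S.eul G) ⬝ᵥ fun α => S.pr (S.opM P (S.eul H)) (S.eul F α)) +
      S.int (S.eul F ⬝ᵥ S.opM (S.prM (S.opM P (S.eul H)) P) (S.eul G)) -
      S.int (S.opM P (S.eul F) ⬝ᵥ fun α => S.pr (S.opM P (S.eul H)) (S.eul G α)) := by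
    intro F G H
    rw [brk, dotProduct_comm, ← int_pr, brk, derivation_dotProduct, pr_opM, dotProduct_add,
      map_add, map_add, hs (S.eul F), dotProduct_comm _ (S.opM P (S.eul G)),
      dotProduct_comm _ (S.opM P (S.eul F))]
    abel
  have h := hjac F G H
  -- The six terms that differentiate δF, δG or δH cancel in pairs by self-adjointness.
  rw [map_add, map_add, key, key, key, S.int_dotProduct_pr_eul (S.opM P (S.eul G)) _ F,
    S.int_dotProduct_pr_eul (S.opM P (S.eul F)) _ G,
    S.int_dotProduct_pr_eul (S.opM P (S.eul F)) _ H] at h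
  rw [← h]
  abel

/-- Along a Hamiltonian flow `K = P δH`, the Hamiltonian operator `P` evolves by
`pr v_K (P) = D_K P + P D_K^*`. -/
theorem prM_eq (hskew : ∀ F G, S.int (S.brk P F G + S.brk P G F) = 0)
    (hjac : ∀ F G H, S.int (S.brk P (S.brk P F G) H + S.brk P (S.brk P G H) F +
      S.brk P (S.brk P H F) G) = 0) (H : B) {K : Fin q → B} (hK : K = S.opM P (S.eul H))
    (Q : Fin q → B) :
    S.opM (S.prM K P) Q = S.opM (fun α => S.d (K α)) (S.opM P Q) +
      S.opM P (S.adjM (fun α => S.d (K α)) Q) := by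
  have hs := int_dotProduct_opM_of_skew hskew
  have hv := int_dotProduct_prM_of_skew hskew
  have hDK : ∀ T, S.opM (fun α => S.d (K α)) T =
      S.opM (S.prM T P) (S.eul H) + S.opM P fun α => S.pr T (S.eul H α) := by
    intro T
    rw [← pr_opM, ← hK]
    rfl
  -- Paired with δF, the P D_K^* term becomes -∫ δL · D_K P δF, so `hDK` applies to both terms;
  -- skewness and Jacobi then match the result.
  have h1 : ∀ L, S.opM (S.prM K P) (S.eul L) + -(S.opM (fun α => S.d (K α)) (S.opM P (S.eul L)) +
      S.opM P (S.adjM (fun α => S.d (K α)) (S.eul L))) = 0 := by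
    intro L
    refine S.eq_zero_of_int_dotProduct_eul fun F => ?_
    have hJ := int_jacobi hskew hjac F L H
    rw [← hK, hv _ (S.eul H)] at hJ
    rw [dotProduct_comm, dotProduct_add, dotProduct_neg, dotProduct_add, map_add, map_neg, map_add,
      hs _ (S.adjM _ _), dotProduct_comm (S.adjM _ _), ← int_dotProduct_opM, hDK, hDK,
      dotProduct_add, dotProduct_add, map_add, map_add, hs (S.eul F), hs (S.eul L),
      dotProduct_comm _ (S.opM P _), dotProduct_comm _ (S.opM P _),
      S.int_dotProduct_pr_eul (S.opM P (S.eul F)), ← hJ]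
    abel
  funext α
  rw [← sub_eq_zero, sub_eq_add_neg]
  refine IsDifferential.eq_zero S (Φ := fun Q => S.opM (S.prM K P) Q α +
    -((S.opM (fun α => S.d (K α)) (S.opM P Q) +
      S.opM P (S.adjM (fun α => S.d (K α)) Q)) α)) ?_ (fun L => congrFun (h1 L) α) Q
  have hcoord := fun β => IsDifferential.coord (S := S) (q := q) β
  exact (IsDifferential.op hcoord _).add (((IsDifferential.op
    (fun β => IsDifferential.op hcoord _) _).add (IsDifferential.op
    (fun β => IsDifferential.sum fun γ _ => (hcoord γ).adj _ _) _)).neg)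

end JetAlgebra

open Asymptotics

/-! ### Taylor expansion in the parameter. -/

section OneVariable

variable {I : Set ℝ}

theorem isLittleO_pow_succ_of_deriv (hI : IsOpen I) (h0 : (0 : ℝ) ∈ I) {φ φ' : ℝ → ℝ} {m : ℕ}
    (hφ : ∀ t ∈ I, HasDerivAt φ (φ' t) t) (hφ0 : φ 0 = 0)
    (hφ' : φ' =o[𝓝 0] fun t => t ^ m) : φ =o[𝓝 0] fun t => t ^ (m + 1) := by
  -- The integrated estimate needs a convex domain, and I is merely open.
  obtain ⟨r, hr, hrI⟩ := Metric.isOpen_iff.1 hI 0 h0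
  have hn : 𝓝[Metric.ball (0 : ℝ) r] 0 = 𝓝 0 :=
    Metric.isOpen_ball.nhdsWithin_eq (Metric.mem_ball_self hr)
  have := (convex_ball (0 : ℝ) r).isLittleO_pow_succ_real (n := m) (Metric.mem_ball_self hr)
    (fun t ht => (hφ t (hrI ht)).hasDerivWithinAt) (by simpa [hn] using hφ')
  simpa [hn, hφ0] using this

/-- Induction through the derivative: the leading monomial of φ differentiates to that of φ'. -/
theorem sub_monomial_isLittleO (hI : IsOpen I) (h0 : (0 : ℝ) ∈ I) (m : ℕ) (φ : ℝ → ℝ)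
    (hφ : ContDiffOn ℝ ∞ φ I) (hz : ∀ k < m, deriv^[k] φ 0 = 0) :
    (fun t => φ t - deriv^[m] φ 0 / m.factorial * t ^ m) =o[𝓝 0] fun t => t ^ m := by
  induction m generalizing φ with
  | zero =>
    have hc : ContinuousAt φ 0 := (hφ.continuousOn.continuousAt (hI.mem_nhds h0))
    simpa [isLittleO_one_iff, tendsto_sub_nhds_zero_iff] using hc.tendsto
  | succ m ih =>
    have hd := ih (deriv φ) (hφ.deriv_of_isOpen hI (by simp)) fun k hk => by
      simpa using hz (k + 1) (by omega)
    refine isLittleO_pow_succ_of_deriv hI h0 (fun t ht => ?_) ?_ hd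
    · have h1 : HasDerivAt φ (deriv φ t) t :=
        ((hφ.differentiableOn (by simp) t ht).differentiableAt (hI.mem_nhds ht)).hasDerivAt
      have h2 := (hasDerivAt_pow (m + 1) t).const_mul (deriv^[m + 1] φ 0 / (m + 1).factorial)
      refine (h1.sub h2).congr_deriv ?_
      rw [Function.iterate_succ_apply, Nat.factorial_succ]
      have : (m.factorial : ℝ) ≠ 0 := by positivity
      have : (m + 1 : ℝ) ≠ 0 := by positivity
      push_cast
      field_simp
    · simpa using hz 0 (by omega)

/-- A smooth function is `o(t^n)` iff its derivatives up to order `n` vanish at `0`. -/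
theorem isLittleO_pow_iff (hI : IsOpen I) (h0 : (0 : ℝ) ∈ I) {n : ℕ} {φ : ℝ → ℝ}
    (hφ : ContDiffOn ℝ ∞ φ I) :
    (φ =o[𝓝 0] fun t => t ^ n) ↔ ∀ k ≤ n, deriv^[k] φ 0 = 0 := by
  constructor
  · intro h k hk
    induction k using Nat.strong_induction_on with
    | _ k ih =>
      have h1 := sub_monomial_isLittleO hI h0 k φ hφ fun j hj => ih j hj (by omega)
      have h2 : φ =o[𝓝 0] fun t => t ^ k := by
        refine h.trans_isBigO ?_
        rw [show n = k + (n - k) by omega]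
        simp only [pow_add]
        have : (fun t : ℝ => t ^ (n - k)) =O[𝓝 0] fun _ => (1 : ℝ) :=
          (ContinuousAt.tendsto (x := (0 : ℝ)) (by fun_prop)).isBigO_one ℝ
        simpa using (isBigO_refl (fun t : ℝ => t ^ k) (𝓝 0)).mul this
      -- The difference is the leading monomial, now o(t^k), so its coefficient must vanish.
      have h3 := h2.sub h1
      simp only [sub_sub_cancel] at h3
      by_contra hne
      have hc : deriv^[k] φ 0 / k.factorial ≠ 0 := by positivity
      rw [isLittleO_const_mul_left_iff hc] at h3
      have hne0 : ∃ᶠ t : ℝ in 𝓝[≠] 0, ‖t ^ k‖ ≠ 0 := by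
        refine Filter.Eventually.frequently ?_
        filter_upwards [self_mem_nhdsWithin] with t ht
        exact norm_ne_zero_iff.2 (pow_ne_zero k ht)
      exact isLittleO_irrefl' hne0 (h3.mono nhdsWithin_le_nhds)
  · intro h
    have := sub_monomial_isLittleO hI h0 n φ hφ fun k hk => h k hk.le
    simpa [h n le_rfl] using this

end OneVariable

/-! ### Differential functions and their directional derivatives. -/

variable {p q : ℕ} {M : Set ((Fin p → ℝ) × (Fin q → ℝ))} {I : Set ℝ}

/-- Equality of functions over `M` for parameters in `I`. -/
def Agree (M : Set ((Fin p → ℝ) × (Fin q → ℝ))) (I : Set ℝ) (F G : JetFun p q) : Prop :=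
  ∀ z ∈ jetsOver M, ∀ ε ∈ I, F z ε = G z ε

/-- The projection onto the `k`-jet. -/
def trunc (k : ℕ) (z : Jet p q) (ε : ℝ) : FinJet p q k := (z.1, fun α J => z.2 α J, ε)

theorem trunc_mem {k : ℕ} {z : Jet p q} {ε : ℝ} :
    trunc k z ε ∈ finJetsOver M I k ↔ z ∈ jetsOver M ∧ ε ∈ I := Iff.rfl

/-- Over `M`, the function `F` is the smooth function `f` of the `k`-jet. -/
def IsRep (M : Set ((Fin p → ℝ) × (Fin q → ℝ))) (I : Set ℝ) (F : JetFun p q) (k : ℕ)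
    (f : FinJet p q k → ℝ) : Prop :=
  ContDiffOn ℝ ∞ f (finJetsOver M I k) ∧ ∀ z ∈ jetsOver M, ∀ ε ∈ I, F z ε = f (trunc k z ε)

theorem isDiffFun_iff {F : JetFun p q} : IsDiffFun M I F ↔ ∃ k f, IsRep M I F k f := Iff.rfl

theorem IsDiffFun.congr {F G : JetFun p q} (hF : IsDiffFun M I F) (h : Agree M I G F) :
    IsDiffFun M I G := by
  obtain ⟨k, f, hf, hFf⟩ := hF
  exact ⟨k, f, hf, fun z hz ε hε => (h z hz ε hε).trans (hFf z hz ε hε)⟩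

theorem IsRep.mono {F : JetFun p q} {k l : ℕ} {f : FinJet p q k → ℝ} (hf : IsRep M I F k f)
    (hkl : k ≤ l) : ∃ g, IsRep M I F l g := by
  have hsub : ∀ J ∈ multiIndices p k, J ∈ multiIndices p l := fun J hJ => by
    rw [mem_multiIndices] at hJ ⊢; omega
  let r : FinJet p q l → FinJet p q k := fun y => (y.1, fun α J => y.2.1 α ⟨J, hsub J J.2⟩, y.2.2)
  refine ⟨f ∘ r, hf.1.comp (t := finJetsOver M I k) ?_ fun y hy => hy, hf.2⟩
  exact ContDiff.contDiffOn (by fun_prop)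

theorem IsDiffFun.exists_common {F G : JetFun p q} (hF : IsDiffFun M I F)
    (hG : IsDiffFun M I G) : ∃ k f g, IsRep M I F k f ∧ IsRep M I G k g := by
  obtain ⟨k, f, hf⟩ := hF
  obtain ⟨l, g, hg⟩ := hG
  obtain ⟨f', hf'⟩ := IsRep.mono hf (le_max_left k l)
  obtain ⟨g', hg'⟩ := IsRep.mono hg (le_max_right k l)
  exact ⟨_, f', g', hf', hg'⟩

theorem IsDiffFun.add {F G : JetFun p q} (hF : IsDiffFun M I F) (hG : IsDiffFun M I G) :
    IsDiffFun M I (F + G) := by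
  obtain ⟨k, f, g, hf, hg⟩ := hF.exists_common hG
  exact ⟨k, f + g, hf.1.add hg.1, fun z hz ε hε => congrArg₂ _ (hf.2 z hz ε hε) (hg.2 z hz ε hε)⟩

theorem IsDiffFun.mul {F G : JetFun p q} (hF : IsDiffFun M I F) (hG : IsDiffFun M I G) :
    IsDiffFun M I (F * G) := by
  obtain ⟨k, f, g, hf, hg⟩ := hF.exists_common hG
  exact ⟨k, f * g, hf.1.mul hg.1, fun z hz ε hε => congrArg₂ _ (hf.2 z hz ε hε) (hg.2 z hz ε hε)⟩

theorem isDiffFun_const (c : ℝ) : IsDiffFun M I fun _ _ => c :=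
  ⟨0, fun _ => c, contDiffOn_const, fun _ _ _ _ => rfl⟩

theorem isDiffFun_coordX (i : Fin p) : IsDiffFun M I fun z _ => z.1 i :=
  ⟨0, fun y => y.1 i, ContDiff.contDiffOn (by fun_prop), fun _ _ _ _ => rfl⟩

theorem isDiffFun_coordU (a : JetIndex p q) : IsDiffFun M I fun z _ => z.2 a.1 a.2 :=
  ⟨∑ i, a.2 i, fun y => y.2.1 a.1 ⟨a.2, mem_multiIndices.2 le_rfl⟩,
    ContDiff.contDiffOn (by fun_prop), fun _ _ _ _ => rfl⟩

/-- The directional derivative along a jet `w` and the amount `e` in the parameter. -/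
def dirDeriv (w : Jet p q) (e : ℝ) (F : JetFun p q) : JetFun p q := fun z ε =>
  deriv (fun s : ℝ => F (z + s • w) (ε + s * e)) 0

theorem eventually_mem (hM : IsOpen M) (hI : IsOpen I) {z : Jet p q} (hz : z ∈ jetsOver M)
    {ε : ℝ} (hε : ε ∈ I) (w : Jet p q) (e : ℝ) :
    ∀ᶠ s : ℝ in 𝓝 0, z + s • w ∈ jetsOver M ∧ ε + s * e ∈ I := by
  -- Lying over M depends only on the 0-jet, so the finite-dimensional space of 0-jets suffices.
  have hc : ContinuousAt (fun s : ℝ => trunc 0 z ε + s • trunc 0 w e) 0 := by fun_prop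
  have hm : finJetsOver M I 0 ∈ 𝓝 (trunc 0 z ε + (0 : ℝ) • trunc 0 w e) := by
    rw [zero_smul, add_zero]
    exact (isOpen_finJetsOver hM hI 0).mem_nhds (trunc_mem.2 ⟨hz, hε⟩)
  exact hc.eventually hm

theorem IsRep.hasDerivAt (hM : IsOpen M) (hI : IsOpen I) {F : JetFun p q} {k : ℕ}
    {f : FinJet p q k → ℝ} (hf : IsRep M I F k f) {z : Jet p q} (hz : z ∈ jetsOver M)
    {ε : ℝ} (hε : ε ∈ I) (w : Jet p q) (e : ℝ) :
    HasDerivAt (fun s : ℝ => F (z + s • w) (ε + s * e))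
      (fderiv ℝ f (trunc k z ε) (trunc k w e)) 0 := by
  have hfd : HasFDerivAt f (fderiv ℝ f (trunc k z ε)) (trunc k z ε + (0 : ℝ) • trunc k w e) := by
    simpa using ((hf.1.contDiffAt ((isOpen_finJetsOver hM hI k).mem_nhds
      (trunc_mem.2 ⟨hz, hε⟩))).differentiableAt (by simp)).hasFDerivAt
  have hg : HasDerivAt (fun s : ℝ => trunc k z ε + s • trunc k w e) (trunc k w e) 0 := by
    simpa using ((hasDerivAt_id (0 : ℝ)).smul_const (trunc k w e)).const_add (trunc k z ε)
  refine (hfd.comp_hasDerivAt (0 : ℝ) hg).congr_of_eventuallyEq ?_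
  filter_upwards [eventually_mem hM hI hz hε w e] with s hs
  exact hf.2 _ hs.1 _ hs.2

theorem IsRep.dirDeriv (hM : IsOpen M) (hI : IsOpen I) {F : JetFun p q} {k : ℕ}
    {f : FinJet p q k → ℝ} (hf : IsRep M I F k f) (w : Jet p q) (e : ℝ) :
    IsRep M I (dirDeriv w e F) k fun y => fderiv ℝ f y (trunc k w e) :=
  ⟨(hf.1.fderiv_of_isOpen (isOpen_finJetsOver hM hI k) (by simp)).clm_apply contDiffOn_const,
    fun _ hz _ hε => (hf.hasDerivAt hM hI hz hε w e).deriv⟩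

theorem IsDiffFun.dirDeriv (hM : IsOpen M) (hI : IsOpen I) {F : JetFun p q}
    (hF : IsDiffFun M I F) (w : Jet p q) (e : ℝ) : IsDiffFun M I (dirDeriv w e F) := by
  obtain ⟨k, f, hf⟩ := isDiffFun_iff.1 hF
  exact ⟨k, _, hf.dirDeriv hM hI w e⟩

theorem IsDiffFun.hasDerivAt (hM : IsOpen M) (hI : IsOpen I) {F : JetFun p q}
    (hF : IsDiffFun M I F) {z : Jet p q} (hz : z ∈ jetsOver M) {ε : ℝ} (hε : ε ∈ I)
    (w : Jet p q) (e : ℝ) :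
    HasDerivAt (fun s : ℝ => F (z + s • w) (ε + s * e)) (ApproxHam.dirDeriv w e F z ε) 0 := by
  obtain ⟨k, f, hf⟩ := isDiffFun_iff.1 hF
  exact (hf.hasDerivAt hM hI hz hε w e).differentiableAt.hasDerivAt

theorem Agree.dirDeriv (hM : IsOpen M) (hI : IsOpen I) {F G : JetFun p q} (h : Agree M I F G)
    (w : Jet p q) (e : ℝ) : Agree M I (dirDeriv w e F) (dirDeriv w e G) := by
  intro z hz ε hε
  refine Filter.EventuallyEq.deriv_eq ?_
  filter_upwards [eventually_mem hM hI hz hε w e] with s hs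
  exact h _ hs.1 _ hs.2

theorem dirDeriv_add (hM : IsOpen M) (hI : IsOpen I) {F G : JetFun p q} (hF : IsDiffFun M I F)
    (hG : IsDiffFun M I G) (w : Jet p q) (e : ℝ) :
    Agree M I (dirDeriv w e (F + G)) (dirDeriv w e F + dirDeriv w e G) :=
  fun _ hz _ hε => ((hF.hasDerivAt hM hI hz hε w e).add (hG.hasDerivAt hM hI hz hε w e)).deriv

theorem dirDeriv_mul (hM : IsOpen M) (hI : IsOpen I) {F G : JetFun p q} (hF : IsDiffFun M I F)
    (hG : IsDiffFun M I G) (w : Jet p q) (e : ℝ) :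
    Agree M I (dirDeriv w e (F * G)) (F * dirDeriv w e G + G * dirDeriv w e F) := by
  intro z hz ε hε
  refine ((hF.hasDerivAt hM hI hz hε w e).mul (hG.hasDerivAt hM hI hz hε w e)).deriv.trans ?_
  simp only [zero_smul, add_zero, zero_mul, Pi.add_apply, Pi.mul_apply]
  ring

theorem dirDeriv_const (c : ℝ) (w : Jet p q) (e : ℝ) :
    dirDeriv w e (fun _ _ => c) = 0 := by
  funext z ε
  simp [dirDeriv]

/-- Both sides are second derivatives of the same smooth representative. Directions include ε, so
jet and ε-derivatives commute too. -/
theorem dirDeriv_comm (hM : IsOpen M) (hI : IsOpen I) {F : JetFun p q} (hF : IsDiffFun M I F)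
    (v w : Jet p q) (d e : ℝ) :
    Agree M I (dirDeriv v d (dirDeriv w e F)) (dirDeriv w e (dirDeriv v d F)) := by
  obtain ⟨k, f, hf⟩ := isDiffFun_iff.1 hF
  intro z hz ε hε
  have hat : ContDiffAt ℝ ∞ f (trunc k z ε) :=
    hf.1.contDiffAt ((isOpen_finJetsOver hM hI k).mem_nhds (trunc_mem.2 ⟨hz, hε⟩))
  have hdiff : DifferentiableAt ℝ (fderiv ℝ f) (trunc k z ε) :=
    (hat.fderiv_right (m := ∞) (by simp)).differentiableAt (by simp)
  have key : ∀ (v w : Jet p q) (d e : ℝ), dirDeriv v d (dirDeriv w e F) z ε =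
      fderiv ℝ (fderiv ℝ f) (trunc k z ε) (trunc k v d) (trunc k w e) := by
    intro v w d e
    rw [((hf.dirDeriv hM hI w e).dirDeriv hM hI v d).2 z hz ε hε]
    beta_reduce
    rw [fderiv_clm_apply hdiff (differentiableAt_const _)]
    simp
  rw [key, key]
  refine hat.isSymmSndFDerivAt ?_ _ _
  rw [minSmoothness_of_isRCLikeNormedField]
  exact WithTop.coe_le_coe.2 (le_top : (2 : ℕ∞) ≤ ⊤)

theorem dirDeriv_zero_one (F : JetFun p q) (z : Jet p q) :
    dirDeriv 0 1 F z = deriv (F z) := by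
  funext ε
  have := deriv_comp_const_add (F z) ε 0
  simpa [dirDeriv] using this

theorem iterate_dirDeriv_zero_one (k : ℕ) (F : JetFun p q) (z : Jet p q) :
    (dirDeriv 0 1)^[k] F z = deriv^[k] (F z) := by
  induction k generalizing F with
  | zero => rfl
  | succ k ih => rw [Function.iterate_succ_apply, Function.iterate_succ_apply, ih,
      dirDeriv_zero_one]

theorem IsDiffFun.iterate_dirDeriv (hM : IsOpen M) (hI : IsOpen I) {F : JetFun p q}
    (hF : IsDiffFun M I F) (w : Jet p q) (e : ℝ) (k : ℕ) :
    IsDiffFun M I ((ApproxHam.dirDeriv w e)^[k] F) := by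
  induction k with
  | zero => exact hF
  | succ k ih => rw [Function.iterate_succ_apply']; exact ih.dirDeriv hM hI w e

theorem iterate_dirDeriv_comm (hM : IsOpen M) (hI : IsOpen I) {F : JetFun p q}
    (hF : IsDiffFun M I F) (v w : Jet p q) (d e : ℝ) (k : ℕ) :
    Agree M I ((dirDeriv v d)^[k] (dirDeriv w e F)) (dirDeriv w e ((dirDeriv v d)^[k] F)) := by
  induction k with
  | zero => exact fun _ _ _ _ => rfl
  | succ k ih =>
    rw [Function.iterate_succ_apply', Function.iterate_succ_apply']
    intro z hz ε hε
    rw [ih.dirDeriv hM hI v d z hz ε hε]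
    exact dirDeriv_comm hM hI (hF.iterate_dirDeriv hM hI v d k) v w d e z hz ε hε

theorem IsDiffFun.contDiffOn_param {F : JetFun p q} (hF : IsDiffFun M I F) {z : Jet p q}
    (hz : z ∈ jetsOver M) : ContDiffOn ℝ ∞ (F z) I := by
  obtain ⟨k, f, hf⟩ := isDiffFun_iff.1 hF
  have : ContDiffOn ℝ ∞ (fun ε => f (trunc k z ε)) I :=
    hf.1.comp (ContDiff.contDiffOn (by unfold trunc; fun_prop)) fun ε hε => trunc_mem.2 ⟨hz, hε⟩
  exact this.congr fun ε hε => hf.2 z hz ε hε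

/-- Differentiation along jets preserves `o(ε^n)`. -/
theorem isLittleO_dirDeriv (hM : IsOpen M) (hI : IsOpen I) (h0 : (0 : ℝ) ∈ I) {n : ℕ}
    {F : JetFun p q} (hF : IsDiffFun M I F)
    (h : ∀ z ∈ jetsOver M, F z =o[𝓝 (0 : ℝ)] fun ε => ε ^ n) (w : Jet p q) :
    ∀ z ∈ jetsOver M, dirDeriv w 0 F z =o[𝓝 (0 : ℝ)] fun ε => ε ^ n := by
  intro z hz
  rw [isLittleO_pow_iff hI h0 ((hF.dirDeriv hM hI w 0).contDiffOn_param hz)]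
  intro k hk
  rw [← iterate_dirDeriv_zero_one, iterate_dirDeriv_comm hM hI hF 0 w 1 0 k z hz 0 h0]
  -- The k-th ε-derivative at ε = 0 vanishes at all jets near z along w, hence so does its
  -- derivative along w.
  have : (fun s : ℝ => (dirDeriv 0 1)^[k] F (z + s • w) (0 + s * 0)) =ᶠ[𝓝 0] fun _ => 0 := by
    filter_upwards [eventually_mem hM hI hz h0 w 0] with s hs
    rw [iterate_dirDeriv_zero_one, mul_zero, add_zero]
    exact (isLittleO_pow_iff hI h0 (hF.contDiffOn_param hs.1)).1 (h _ hs.1) k hk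
  rw [dirDeriv, this.deriv_eq, deriv_const]

/-- The direction of the coordinate `x^i`. -/
def dirX (i : Fin p) : Jet p q := (Pi.single i 1, 0)

/-- The direction of the coordinate `u^α_J`. -/
def dirU (a : JetIndex p q) : Jet p q := (0, Pi.single a.1 (Pi.single a.2 1))

theorem partialX_eq (i : Fin p) (F : JetFun p q) : partialX i F = dirDeriv (dirX i) 0 F := by
  funext z ε
  have h := deriv_comp_const_add (fun s : ℝ => F (Function.update z.1 i s, z.2) ε) (z.1 i) 0
  rw [add_zero] at h
  rw [partialX, ← h, dirDeriv]
  congr 1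
  funext s
  congr 1
  · ext j
    · by_cases hj : j = i
      · subst hj; simp [dirX]
      · simp [dirX, hj]
    · simp [dirX]
  · simp

theorem partialU_eq (a : JetIndex p q) (F : JetFun p q) :
    partialU a.1 a.2 F = dirDeriv (dirU a) 0 F := by
  funext z ε
  have h := deriv_comp_const_add (fun s : ℝ =>
    F (z.1, Function.update z.2 a.1 (Function.update (z.2 a.1) a.2 s)) ε) (z.2 a.1 a.2) 0
  rw [add_zero] at h
  rw [partialU, ← h, dirDeriv]
  congr 1
  funext s
  congr 1
  · ext α J
    · simp [dirU]
    · by_cases hα : α = a.1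
      · subst hα
        by_cases hJ : J = a.2
        · subst hJ; simp [dirU]
        · simp [dirU, hJ]
      · simp [dirU, hα]
  · simp

theorem IsDiffFun.partialX (hM : IsOpen M) (hI : IsOpen I) {F : JetFun p q}
    (hF : IsDiffFun M I F) (i : Fin p) : IsDiffFun M I (partialX i F) := by
  rw [partialX_eq]; exact hF.dirDeriv hM hI _ _

theorem IsDiffFun.partialU (hM : IsOpen M) (hI : IsOpen I) {F : JetFun p q}
    (hF : IsDiffFun M I F) (α : Fin q) (J : MultiIndex p) : IsDiffFun M I (partialU α J F) := by
  rw [partialU_eq (α, J)]; exact hF.dirDeriv hM hI _ _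

theorem IsDiffFun.exists_partialU_eq_zero (hM : IsOpen M) (hI : IsOpen I) {F : JetFun p q}
    (hF : IsDiffFun M I F) : ∃ s : Finset (MultiIndex p), ∀ α, ∀ J ∉ s,
      Agree M I (ApproxHam.partialU α J F) 0 := by
  obtain ⟨k, f, hf⟩ := isDiffFun_iff.1 hF
  refine ⟨multiIndices p k, fun α J hJ z hz ε hε => ?_⟩
  rw [partialU_eq (α, J), (hf.dirDeriv hM hI _ _).2 z hz ε hε]
  have : trunc k (dirU (α, J)) 0 = (0 : FinJet p q k) := by
    ext β L
    · simp [trunc, dirU]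
    · have hLJ : (L : MultiIndex p) ≠ J := fun h => hJ (h ▸ L.2)
      by_cases hβ : β = α
      · subst hβ; simp [trunc, dirU, hLJ]
      · simp [trunc, dirU, hβ]
    · simp [trunc]
  simp [this]

/-! ### The quotient modulo o(ε^n) as a jet algebra. -/

/-- The algebra of differential functions. -/
def diffAlg (M : Set ((Fin p → ℝ) × (Fin q → ℝ))) (I : Set ℝ) : Subalgebra ℝ (JetFun p q) where
  carrier := {F | IsDiffFun M I F}
  mul_mem' := IsDiffFun.mul
  add_mem' := IsDiffFun.add
  algebraMap_mem' c := isDiffFun_const c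

/-- The ideal of differential functions that are `o(ε^n)`. -/
def nullIdeal (M : Set ((Fin p → ℝ) × (Fin q → ℝ))) (hI : IsOpen I) (h0 : (0 : ℝ) ∈ I) (n : ℕ) :
    Ideal (diffAlg M I) where
  carrier := {F | ∀ z ∈ jetsOver M, (F : JetFun p q) z =o[𝓝 (0 : ℝ)] fun ε => ε ^ n}
  zero_mem' _ _ := isLittleO_zero _ _
  add_mem' hF hG z hz := (hF z hz).add (hG z hz)
  smul_mem' G F hF z hz := by
    -- A differential function is continuous in ε at 0, hence bounded there.
    have hG : (G : JetFun p q) z =O[𝓝 (0 : ℝ)] fun _ => (1 : ℝ) :=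
      ((G.2.contDiffOn_param hz).continuousOn.continuousAt (hI.mem_nhds h0)).tendsto.isBigO_one ℝ
    exact (hG.mul_isLittleO (hF z hz)).congr_right fun ε => one_mul _

/-- Differential functions up to `o(ε^n)`. -/
def DiffQuot (M : Set ((Fin p → ℝ) × (Fin q → ℝ))) (hI : IsOpen I) (h0 : (0 : ℝ) ∈ I)
    (n : ℕ) : Type := diffAlg M I ⧸ nullIdeal M hI h0 n

instance (hI : IsOpen I) (h0 : (0 : ℝ) ∈ I) (n : ℕ) : CommRing (DiffQuot M hI h0 n) :=
  inferInstanceAs (CommRing (diffAlg M I ⧸ nullIdeal M hI h0 n))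

instance (hI : IsOpen I) (h0 : (0 : ℝ) ∈ I) (n : ℕ) : Algebra ℝ (DiffQuot M hI h0 n) :=
  inferInstanceAs (Algebra ℝ (diffAlg M I ⧸ nullIdeal M hI h0 n))

/-- The quotient map. -/
def DiffQuot.mk (M : Set ((Fin p → ℝ) × (Fin q → ℝ))) (hI : IsOpen I) (h0 : (0 : ℝ) ∈ I)
    (n : ℕ) : diffAlg M I →ₐ[ℝ] DiffQuot M hI h0 n :=
  Ideal.Quotient.mkₐ ℝ (nullIdeal M hI h0 n)

open Classical in
/-- The class of a differential function (`0` for other functions). -/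
def cls (M : Set ((Fin p → ℝ) × (Fin q → ℝ))) (hI : IsOpen I) (h0 : (0 : ℝ) ∈ I) (n : ℕ)
    (F : JetFun p q) : DiffQuot M hI h0 n :=
  if h : IsDiffFun M I F then DiffQuot.mk M hI h0 n ⟨F, h⟩ else 0

variable (hM : IsOpen M) (hI : IsOpen I) (h0 : (0 : ℝ) ∈ I) (n : ℕ) {F G : JetFun p q}

theorem cls_of (hF : IsDiffFun M I F) :
    cls M hI h0 n F = DiffQuot.mk M hI h0 n ⟨F, hF⟩ := dif_pos hF

theorem exists_cls_eq (b : DiffQuot M hI h0 n) : ∃ F, IsDiffFun M I F ∧ cls M hI h0 n F = b := by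
  obtain ⟨F, rfl⟩ := Ideal.Quotient.mk_surjective b
  exact ⟨F, F.2, cls_of hI h0 n F.2⟩

theorem cls_eq_iff (hF : IsDiffFun M I F) (hG : IsDiffFun M I G) :
    cls M hI h0 n F = cls M hI h0 n G ↔ Approx M n F G := by
  rw [cls_of hI h0 n hF, cls_of hI h0 n hG]
  exact Ideal.Quotient.eq

theorem cls_congr (hG : IsDiffFun M I G) (h : Agree M I F G) :
    cls M hI h0 n F = cls M hI h0 n G := by
  rw [cls_eq_iff hI h0 n (hG.congr h) hG]
  intro z hz
  refine (isLittleO_zero (E' := ℝ) _ _).congr' ?_ Filter.EventuallyEq.rfl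
  filter_upwards [hI.mem_nhds h0] with ε hε
  rw [h z hz ε hε, sub_self]

theorem cls_add (hF : IsDiffFun M I F) (hG : IsDiffFun M I G) :
    cls M hI h0 n (F + G) = cls M hI h0 n F + cls M hI h0 n G := by
  rw [cls_of hI h0 n hF, cls_of hI h0 n hG, cls_of hI h0 n (hF.add hG), ← map_add]
  rfl

theorem cls_mul (hF : IsDiffFun M I F) (hG : IsDiffFun M I G) :
    cls M hI h0 n (F * G) = cls M hI h0 n F * cls M hI h0 n G := by
  rw [cls_of hI h0 n hF, cls_of hI h0 n hG, cls_of hI h0 n (hF.mul hG), ← map_mul]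
  rfl

theorem cls_const (c : ℝ) :
    cls M hI h0 n (fun _ _ => c) = algebraMap ℝ (DiffQuot M hI h0 n) c :=
  (cls_of hI h0 n (isDiffFun_const c)).trans ((DiffQuot.mk M hI h0 n).commutes c)

theorem cls_zero : cls M hI h0 n 0 = 0 := (cls_const hI h0 n 0).trans (map_zero _)

theorem IsDiffFun.const_mul (hF : IsDiffFun M I F) (c : ℝ) :
    IsDiffFun M I fun z ε => c * F z ε := (isDiffFun_const c).mul hF

theorem cls_const_mul (hF : IsDiffFun M I F) (c : ℝ) :
    cls M hI h0 n (fun z ε => c * F z ε) = c • cls M hI h0 n F := by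
  rw [Algebra.smul_def, ← cls_const, ← cls_mul hI h0 n (isDiffFun_const c) hF]
  rfl

theorem IsDiffFun.zero : IsDiffFun M I (0 : JetFun p q) := isDiffFun_const 0

theorem IsDiffFun.sum {ι : Type*} {s : Finset ι} {G : ι → JetFun p q}
    (hG : ∀ i ∈ s, IsDiffFun M I (G i)) : IsDiffFun M I (∑ i ∈ s, G i) :=
  (diffAlg M I).sum_mem hG

theorem cls_sum {ι : Type*} {s : Finset ι} {G : ι → JetFun p q}
    (hG : ∀ i ∈ s, IsDiffFun M I (G i)) :
    cls M hI h0 n (∑ i ∈ s, G i) = ∑ i ∈ s, cls M hI h0 n (G i) := by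
  classical
  induction s using Finset.induction_on with
  | empty => simpa using cls_zero hI h0 n
  | insert i s hi ih =>
    rw [Finset.sum_insert hi, Finset.sum_insert hi, cls_add hI h0 n (hG i (by simp))
      (IsDiffFun.sum fun j hj => hG j (by simp [hj])), ih fun j hj => hG j (by simp [hj])]

theorem agree_finsum {G : MultiIndex p → JetFun p q} {s : Finset (MultiIndex p)}
    (h : ∀ J ∉ s, Agree M I (G J) 0) :
    Agree M I (fun z ε => ∑ᶠ J, G J z ε) (∑ J ∈ s, G J) := by
  intro z hz ε hε
  rw [Finset.sum_apply, Finset.sum_apply]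
  refine finsum_eq_sum_of_support_subset _ fun J hJ => ?_
  by_contra hJs
  exact hJ (h J hJs z hz ε hε)

theorem agree_sum_finsum {G : Fin q → MultiIndex p → JetFun p q} {s : Finset (MultiIndex p)}
    (h : ∀ α, ∀ J ∉ s, Agree M I (G α J) 0) :
    Agree M I (fun z ε => ∑ α, ∑ᶠ J, G α J z ε) (∑ α, ∑ J ∈ s, G α J) := by
  intro z hz ε hε
  rw [Finset.sum_apply, Finset.sum_apply]
  exact Finset.sum_congr rfl fun α _ => agree_finsum (h α) z hz ε hε

theorem Agree.mul_zero_left {F G : JetFun p q} (h : Agree M I G 0) :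
    Agree M I (fun z ε => F z ε * G z ε) 0 := fun z hz ε hε => by simp [h z hz ε hε]

theorem Agree.mul_zero_right {F G : JetFun p q} (h : Agree M I F 0) :
    Agree M I (fun z ε => F z ε * G z ε) 0 := fun z hz ε hε => by simp [h z hz ε hε]

/-- The derivation on classes induced by the derivative along `w`. -/
def quotDeriv (w : Jet p q) (b : DiffQuot M hI h0 n) : DiffQuot M hI h0 n :=
  cls M hI h0 n (dirDeriv w 0 (exists_cls_eq hI h0 n b).choose)

/-- Independence of the chosen representative: apply `isLittleO_dirDeriv` to the difference of two
of them. -/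
theorem quotDeriv_cls (hM : IsOpen M) (w : Jet p q) (hF : IsDiffFun M I F) :
    quotDeriv hI h0 n w (cls M hI h0 n F) = cls M hI h0 n (dirDeriv w 0 F) := by
  obtain ⟨hG, hGF⟩ := (exists_cls_eq hI h0 n (cls M hI h0 n F)).choose_spec
  rw [quotDeriv]
  set G := (exists_cls_eq hI h0 n (cls M hI h0 n F)).choose
  rw [cls_eq_iff hI h0 n hG hF] at hGF
  rw [cls_eq_iff hI h0 n (hG.dirDeriv hM hI w 0) (hF.dirDeriv hM hI w 0)]
  have hF' : IsDiffFun M I fun z ε => -1 * F z ε := hF.const_mul (-1)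
  intro z hz
  refine (isLittleO_dirDeriv hM hI h0 (n := n) (hG.add hF') (fun z hz => ?_) w z hz).congr' ?_
    Filter.EventuallyEq.rfl
  · refine (hGF z hz).congr_left fun ε => ?_
    simp [sub_eq_add_neg]
  · filter_upwards [hI.mem_nhds h0] with ε hε
    rw [((hG.hasDerivAt hM hI hz hε w 0).sub (hF.hasDerivAt hM hI hz hε w 0)).deriv.symm, dirDeriv]
    congr 1
    funext s
    simp [sub_eq_add_neg]

/-- `quotDeriv` as a derivation. -/
def quotDerivation (w : Jet p q) : Derivation ℝ (DiffQuot M hI h0 n) (DiffQuot M hI h0 n) :=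
  Derivation.mk'
    { toFun := quotDeriv hI h0 n w
      map_add' := fun a b => by
        obtain ⟨F, hF, rfl⟩ := exists_cls_eq hI h0 n a
        obtain ⟨G, hG, rfl⟩ := exists_cls_eq hI h0 n b
        rw [← cls_add hI h0 n hF hG, quotDeriv_cls hI h0 n hM w hF,
          quotDeriv_cls hI h0 n hM w hG, quotDeriv_cls hI h0 n hM w (hF.add hG),
          ← cls_add hI h0 n (hF.dirDeriv hM hI w 0) (hG.dirDeriv hM hI w 0)]
        exact cls_congr hI h0 n ((hF.dirDeriv hM hI w 0).add (hG.dirDeriv hM hI w 0))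
          (dirDeriv_add hM hI hF hG w 0)
      map_smul' := fun c b => by
        obtain ⟨F, hF, rfl⟩ := exists_cls_eq hI h0 n b
        rw [← cls_const_mul hI h0 n hF, quotDeriv_cls hI h0 n hM w hF,
          quotDeriv_cls hI h0 n hM w (hF.const_mul c), RingHom.id_apply,
          ← cls_const_mul hI h0 n (hF.dirDeriv hM hI w 0)]
        refine cls_congr hI h0 n ((hF.dirDeriv hM hI w 0).const_mul c) fun z hz ε hε => ?_
        exact ((hF.hasDerivAt hM hI hz hε w 0).const_mul c).deriv }
    fun a b => by
      obtain ⟨F, hF, rfl⟩ := exists_cls_eq hI h0 n a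
      obtain ⟨G, hG, rfl⟩ := exists_cls_eq hI h0 n b
      have hF' := hF.dirDeriv hM hI w 0
      have hG' := hG.dirDeriv hM hI w 0
      rw [← cls_mul hI h0 n hF hG]
      change quotDeriv hI h0 n w _ = _ • quotDeriv hI h0 n w _ + _ • quotDeriv hI h0 n w _
      rw [quotDeriv_cls hI h0 n hM w hF, quotDeriv_cls hI h0 n hM w hG,
        quotDeriv_cls hI h0 n hM w (hF.mul hG), smul_eq_mul, smul_eq_mul,
        ← cls_mul hI h0 n hF hG', ← cls_mul hI h0 n hG hF',
        ← cls_add hI h0 n (hF.mul hG') (hG.mul hF')]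
      exact cls_congr hI h0 n ((hF.mul hG').add (hG.mul hF')) (dirDeriv_mul hM hI hF hG w 0)

theorem quotDerivation_cls (w : Jet p q) (hF : IsDiffFun M I F) :
    quotDerivation hM hI h0 n w (cls M hI h0 n F) = cls M hI h0 n (dirDeriv w 0 F) :=
  quotDeriv_cls hI h0 n hM w hF

theorem quotDerivation_comm (v w : Jet p q) (b : DiffQuot M hI h0 n) :
    quotDerivation hM hI h0 n v (quotDerivation hM hI h0 n w b) =
      quotDerivation hM hI h0 n w (quotDerivation hM hI h0 n v b) := by
  obtain ⟨F, hF, rfl⟩ := exists_cls_eq hI h0 n b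
  have hv := hF.dirDeriv hM hI v 0
  have hw := hF.dirDeriv hM hI w 0
  rw [quotDerivation_cls hM hI h0 n w hF, quotDerivation_cls hM hI h0 n v hF,
    quotDerivation_cls hM hI h0 n v hw, quotDerivation_cls hM hI h0 n w hv]
  exact cls_congr hI h0 n (hv.dirDeriv hM hI w 0) (dirDeriv_comm hM hI hF v w 0 0)

/-- Finite jet order lets the vertical differential take finitely supported values. -/
theorem quotDerivation_finite (b : DiffQuot M hI h0 n) :
    (Function.support fun a : JetIndex p q => quotDerivation hM hI h0 n (dirU a) b).Finite := by
  obtain ⟨F, hF, rfl⟩ := exists_cls_eq hI h0 n b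
  obtain ⟨s, hs⟩ := hF.exists_partialU_eq_zero hM hI
  refine (Finset.finite_toSet (Finset.univ ×ˢ s)).subset fun a ha => ?_
  by_contra has
  refine ha ?_
  change quotDerivation hM hI h0 n (dirU a) _ = 0
  rw [quotDerivation_cls hM hI h0 n _ hF, ← partialU_eq, ← cls_zero hI h0 n]
  exact cls_congr hI h0 n IsDiffFun.zero (hs a.1 a.2 (by simpa using has))

/-- Derivatives of the coordinate functions. -/
theorem quotDerivation_coordX (w : Jet p q) (i : Fin p) :
    quotDerivation hM hI h0 n w (cls M hI h0 n fun z _ => z.1 i) =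
      algebraMap ℝ _ (w.1 i) := by
  rw [quotDerivation_cls hM hI h0 n w (isDiffFun_coordX i), ← cls_const]
  congr 1
  funext z ε
  have : HasDerivAt (fun s : ℝ => z.1 i + s * w.1 i) (w.1 i) 0 := by
    simpa using ((hasDerivAt_id (0 : ℝ)).mul_const (w.1 i)).const_add (z.1 i)
  exact this.deriv

theorem quotDerivation_coordU (w : Jet p q) (a : JetIndex p q) :
    quotDerivation hM hI h0 n w (cls M hI h0 n fun z _ => z.2 a.1 a.2) =
      algebraMap ℝ _ (w.2 a.1 a.2) := by
  rw [quotDerivation_cls hM hI h0 n w (isDiffFun_coordU a), ← cls_const]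
  congr 1
  funext z ε
  have : HasDerivAt (fun s : ℝ => z.2 a.1 a.2 + s * w.2 a.1 a.2) (w.2 a.1 a.2) 0 := by
    simpa using ((hasDerivAt_id (0 : ℝ)).mul_const (w.2 a.1 a.2)).const_add (z.2 a.1 a.2)
  exact this.deriv

/-- Differential functions up to `o(ε^n)` form a jet algebra. -/
def diffJetAlgebra : JetAlgebra p q (DiffQuot M hI h0 n) where
  X i := quotDerivation hM hI h0 n (dirX i)
  d := Derivation.mk'
    { toFun := fun b => Finsupp.ofSupportFinite
        (fun a => quotDerivation hM hI h0 n (dirU a) b) (quotDerivation_finite hM hI h0 n b)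
      map_add' := fun a b => by
        ext c
        exact map_add (quotDerivation hM hI h0 n (dirU c)) a b
      map_smul' := fun r b => by
        ext c
        exact (quotDerivation hM hI h0 n (dirU c)).map_smul r b }
    fun a b => by
      ext c
      exact (quotDerivation hM hI h0 n (dirU c)).leibniz a b
  x i := cls M hI h0 n fun z _ => z.1 i
  u a := cls M hI h0 n fun z _ => z.2 a.1 a.2
  X_x i j := by
    rw [quotDerivation_coordX]
    by_cases h : i = j
    · subst h; simp [dirX]
    · simp [dirX, h, Ne.symm h]
  X_u i a := by
    rw [quotDerivation_coordU]
    simp [dirX]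
  d_x j := by
    ext a
    change quotDerivation hM hI h0 n (dirU a) _ = 0
    rw [quotDerivation_coordX]
    simp [dirU]
  d_u a := by
    classical
    ext b
    change quotDerivation hM hI h0 n (dirU b) _ = _
    rw [quotDerivation_coordU, Finsupp.single_apply]
    by_cases h : a = b
    · subst h; simp [dirU]
    · have : (dirU b : Jet p q).2 a.1 a.2 = 0 := by
        by_cases h1 : a.1 = b.1
        · have h2 : a.2 ≠ b.2 := fun h2 => h (Prod.ext h1 h2)
          simp [dirU, h1, h2]
        · simp [dirU, h1]
      rw [this, if_neg h, map_zero]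
  X_comm i j b := quotDerivation_comm hM hI h0 n _ _ b
  d_X i b a := quotDerivation_comm hM hI h0 n _ _ b
  d_comm b a c := quotDerivation_comm hM hI h0 n _ _ b

/-! ### Transfer of the jet operations to the quotient. -/

theorem Agree.totalD (hM : IsOpen M) (hI : IsOpen I) (h : Agree M I F G) (i : Fin p) :
    Agree M I (totalD i F) (totalD i G) := by
  intro z hz ε hε
  unfold ApproxHam.totalD
  congr 1
  · rw [partialX_eq, partialX_eq]
    exact h.dirDeriv hM hI _ _ z hz ε hε
  · refine Finset.sum_congr rfl fun α _ => finsum_congr fun J => ?_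
    rw [partialU_eq (α, J), partialU_eq (α, J), h.dirDeriv hM hI _ _ z hz ε hε]

theorem Agree.multiD (hM : IsOpen M) (hI : IsOpen I) (h : Agree M I F G) (J : MultiIndex p) :
    Agree M I (multiD J F) (multiD J G) := by
  unfold ApproxHam.multiD
  induction List.finRange p with
  | nil => exact h
  | cons i l ih =>
    simp only [List.foldr_cons]
    induction J i with
    | zero => exact ih
    | succ k ihk =>
      rw [Function.iterate_succ_apply', Function.iterate_succ_apply']
      exact ihk.totalD hM hI i

theorem multiD_zero_right (J : MultiIndex p) : multiD J (0 : JetFun p q) = 0 := by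
  have hD : ∀ i : Fin p, totalD i (0 : JetFun p q) = 0 := fun i => by
    funext z ε
    simp [totalD, partialX, partialU]
  unfold multiD
  induction List.finRange p with
  | nil => rfl
  | cons i l ih => rw [List.foldr_cons, ih, Function.iterate_fixed (hD i)]

/-- Model for the `_spec` lemmas: each operation preserves differential functions and induces its
algebraic counterpart on classes. Off M the support may be infinite, so the finite sum replaces the
`finsum` only over M and I. -/
theorem finsum_spec {G : MultiIndex p → JetFun p q} (hG : ∀ J, IsDiffFun M I (G J))
    {s : Finset (MultiIndex p)} (h : ∀ J ∉ s, Agree M I (G J) 0) :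
    IsDiffFun M I (fun z ε => ∑ᶠ J, G J z ε) ∧
      cls M hI h0 n (fun z ε => ∑ᶠ J, G J z ε) = ∑ J ∈ s, cls M hI h0 n (G J) := by
  have hs : IsDiffFun M I (∑ J ∈ s, G J) := IsDiffFun.sum fun J _ => hG J
  exact ⟨hs.congr (agree_finsum h), by
    rw [cls_congr hI h0 n hs (agree_finsum h), cls_sum hI h0 n fun J _ => hG J]⟩

theorem sum_finsum_spec {G : Fin q → MultiIndex p → JetFun p q}
    (hG : ∀ α J, IsDiffFun M I (G α J)) {s : Finset (MultiIndex p)}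
    (h : ∀ α, ∀ J ∉ s, Agree M I (G α J) 0) :
    IsDiffFun M I (fun z ε => ∑ α, ∑ᶠ J, G α J z ε) ∧
      cls M hI h0 n (fun z ε => ∑ α, ∑ᶠ J, G α J z ε) =
        ∑ α, ∑ J ∈ s, cls M hI h0 n (G α J) := by
  have h1 := fun α => IsDiffFun.sum (s := s) fun J _ => hG α J
  have hs : IsDiffFun M I (∑ α, ∑ J ∈ s, G α J) := IsDiffFun.sum fun α _ => h1 α
  refine ⟨hs.congr (agree_sum_finsum h), ?_⟩
  rw [cls_congr hI h0 n hs (agree_sum_finsum h), cls_sum hI h0 n fun α _ => h1 α]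
  exact Finset.sum_congr rfl fun α _ => cls_sum hI h0 n fun J _ => hG α J

theorem d_cls (hF : IsDiffFun M I F) (a : JetIndex p q) :
    (diffJetAlgebra hM hI h0 n).d (cls M hI h0 n F) a =
      cls M hI h0 n (partialU a.1 a.2 F) := by
  change quotDerivation hM hI h0 n (dirU a) _ = _
  rw [quotDerivation_cls hM hI h0 n _ hF, partialU_eq]

theorem support_d_cls (hF : IsDiffFun M I F) {s : Finset (MultiIndex p)}
    (hs : ∀ α, ∀ J ∉ s, Agree M I (partialU α J F) 0) :
    ((diffJetAlgebra hM hI h0 n).d (cls M hI h0 n F)).support ⊆ Finset.univ ×ˢ s := by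
  intro a ha
  by_contra has
  rw [Finsupp.mem_support_iff, d_cls hM hI h0 n hF] at ha
  refine ha ?_
  rw [← cls_zero hI h0 n]
  exact cls_congr hI h0 n IsDiffFun.zero (hs a.1 a.2 (by simpa using has))

theorem totalD_spec (hF : IsDiffFun M I F) (i : Fin p) :
    IsDiffFun M I (totalD i F) ∧
      cls M hI h0 n (totalD i F) = (diffJetAlgebra hM hI h0 n).totD i (cls M hI h0 n F) := by
  obtain ⟨s, hs⟩ := hF.exists_partialU_eq_zero hM hI
  have hX := hF.partialX hM hI i
  have hU := fun α J => hF.partialU hM hI α J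
  have hu := fun a : JetIndex p q => isDiffFun_coordU (M := M) (I := I) (a.shift i)
  obtain ⟨h1, h2⟩ := sum_finsum_spec (M := M) hI h0 n
    (G := fun α J z ε => z.2 α (J + Pi.single i 1) * partialU α J F z ε)
    (fun α J => (hu (α, J)).mul (hU α J)) (fun α J hJ => (hs α J hJ).mul_zero_left)
  refine ⟨hX.add h1, (cls_add hI h0 n hX h1).trans ?_⟩
  rw [h2, JetAlgebra.totD_apply, JetAlgebra.vert_eq_sum _ _ _ (support_d_cls hM hI h0 n hF hs),
    Finset.sum_product]
  congr 1
  · change _ = quotDerivation hM hI h0 n (dirX i) _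
    rw [quotDerivation_cls hM hI h0 n _ hF, partialX_eq]
  · refine Finset.sum_congr rfl fun α _ => Finset.sum_congr rfl fun J _ => ?_
    rw [d_cls hM hI h0 n hF, mul_comm]
    exact cls_mul hI h0 n (hu (α, J)) (hU α J)

theorem multiD_spec (hF : IsDiffFun M I F) (J : MultiIndex p) :
    IsDiffFun M I (multiD J F) ∧
      cls M hI h0 n (multiD J F) = (diffJetAlgebra hM hI h0 n).mD J (cls M hI h0 n F) := by
  unfold multiD JetAlgebra.mD
  induction List.finRange p with
  | nil => exact ⟨hF, rfl⟩
  | cons i l ih =>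
    simp only [List.foldr_cons, List.map_cons, List.prod_cons]
    induction J i with
    | zero => simpa using ih
    | succ k ihk =>
      have h := totalD_spec hM hI h0 n ihk.1 i
      rw [Function.iterate_succ_apply', pow_succ', mul_assoc]
      refine ⟨h.1, ?_⟩
      rw [h.2, ihk.2]
      rfl

theorem sD_spec (hF : IsDiffFun M I F) (J : MultiIndex p) :
    IsDiffFun M I (fun z ε => multiSign J * multiD J F z ε) ∧
      cls M hI h0 n (fun z ε => multiSign J * multiD J F z ε) =
        (diffJetAlgebra hM hI h0 n).sD J (cls M hI h0 n F) := by
  obtain ⟨h1, h2⟩ := multiD_spec hM hI h0 n hF J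
  refine ⟨h1.const_mul _, ?_⟩
  rw [cls_const_mul hI h0 n h1, h2]
  rfl

theorem agree_sD_zero (hM : IsOpen M) (hI : IsOpen I) (hF : Agree M I F 0) (J : MultiIndex p) :
    Agree M I (fun z ε => multiSign J * multiD J F z ε) 0 := by
  refine Agree.mul_zero_left (F := fun _ _ => multiSign J) ?_
  have := hF.multiD hM hI J
  rwa [multiD_zero_right] at this

theorem euler_spec (hF : IsDiffFun M I F) (α : Fin q) :
    IsDiffFun M I (euler F α) ∧
      cls M hI h0 n (euler F α) = (diffJetAlgebra hM hI h0 n).eul (cls M hI h0 n F) α := by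
  obtain ⟨s, hs⟩ := hF.exists_partialU_eq_zero hM hI
  have h := fun J => sD_spec hM hI h0 n (hF.partialU hM hI α J) J
  obtain ⟨h1, h2⟩ := finsum_spec (M := M) hI h0 n (fun J => (h J).1)
    fun J hJ => agree_sD_zero hM hI (hs α J hJ) J
  refine ⟨h1, h2.trans ?_⟩
  rw [JetAlgebra.eul, JetAlgebra.adj_eq_sum _ _ _ _ (support_d_cls hM hI h0 n hF hs)]
  exact Finset.sum_congr rfl fun J _ => by rw [(h J).2, d_cls hM hI h0 n hF, mul_one]

/-- The classes of the components of a tuple. -/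
def clsTuple (M : Set ((Fin p → ℝ) × (Fin q → ℝ))) (hI : IsOpen I) (h0 : (0 : ℝ) ∈ I) (n : ℕ)
    (Q : JetTuple p q) : Fin q → DiffQuot M hI h0 n := fun α => cls M hI h0 n (Q α)

theorem clsTuple_euler (hF : IsDiffFun M I F) :
    clsTuple M hI h0 n (euler F) = (diffJetAlgebra hM hI h0 n).eul (cls M hI h0 n F) :=
  funext fun α => (euler_spec hM hI h0 n hF α).2

theorem prolong_spec {Q : JetTuple p q} (hQ : IsDiffTuple M I Q) (hF : IsDiffFun M I F) :
    IsDiffFun M I (prolong Q F) ∧ cls M hI h0 n (prolong Q F) =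
      (diffJetAlgebra hM hI h0 n).pr (clsTuple M hI h0 n Q) (cls M hI h0 n F) := by
  obtain ⟨s, hs⟩ := hF.exists_partialU_eq_zero hM hI
  have hU := fun α J => hF.partialU hM hI α J
  have hD := fun α J => multiD_spec hM hI h0 n (hQ α) J
  obtain ⟨h1, h2⟩ := sum_finsum_spec (M := M) hI h0 n
    (G := fun α J z ε => multiD J (Q α) z ε * partialU α J F z ε)
    (fun α J => (hD α J).1.mul (hU α J)) (fun α J hJ => (hs α J hJ).mul_zero_left)
  refine ⟨h1, h2.trans ?_⟩
  rw [JetAlgebra.pr_apply, JetAlgebra.op_eq_sum _ _ _ (support_d_cls hM hI h0 n hF hs)]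
  refine Finset.sum_congr rfl fun α _ => Finset.sum_congr rfl fun J _ => ?_
  rw [d_cls hM hI h0 n hF, mul_comm, clsTuple, ← (hD α J).2]
  exact cls_mul hI h0 n (hD α J).1 (hU α J)

theorem Agree.prolong (hM : IsOpen M) (hI : IsOpen I) (Q : JetTuple p q) (h : Agree M I F 0) :
    Agree M I (prolong Q F) 0 := by
  intro z hz ε hε
  refine Finset.sum_eq_zero fun α _ => finsum_eq_zero_of_forall_eq_zero fun J => ?_
  rw [partialU_eq (α, J), h.dirDeriv hM hI _ _ z hz ε hε]
  rw [show ApproxHam.dirDeriv (dirU (α, J)) 0 (0 : JetFun p q) = 0 from dirDeriv_const 0 _ _]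
  exact mul_zero _

variable {D : DiffOp p q}

theorem coef_finite (hD : IsDiffOp M I D) (α : Fin q) :
    (Function.support fun a : JetIndex p q => cls M hI h0 n (D α a.1 a.2)).Finite := by
  obtain ⟨s, hs⟩ := hD.2
  refine (Finset.finite_toSet (Finset.univ ×ˢ s)).subset fun a ha => ?_
  by_contra has
  refine ha ?_
  change cls M hI h0 n (D α a.1 a.2) = 0
  rw [← cls_zero hI h0 n]
  exact cls_congr hI h0 n IsDiffFun.zero (hs α a.1 a.2 (by simpa using has))

/-- The coefficients of an operator, up to `o(ε^n)`. -/
def coef (hD : IsDiffOp M I D) (α : Fin q) : JetIndex p q →₀ DiffQuot M hI h0 n :=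
  Finsupp.ofSupportFinite (fun a => cls M hI h0 n (D α a.1 a.2)) (coef_finite hI h0 n hD α)

theorem coef_apply (hD : IsDiffOp M I D) (α : Fin q) (a : JetIndex p q) :
    coef hI h0 n hD α a = cls M hI h0 n (D α a.1 a.2) := rfl

theorem exists_support_coef (hD : IsDiffOp M I D) : ∃ s : Finset (MultiIndex p),
    (∀ α β, ∀ J ∉ s, Agree M I (D α β J) 0) ∧
      ∀ α, (coef hI h0 n hD α).support ⊆ Finset.univ ×ˢ s := by
  obtain ⟨s, hs⟩ := hD.2
  refine ⟨s, hs, fun α a ha => ?_⟩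
  by_contra has
  rw [Finsupp.mem_support_iff, coef_apply] at ha
  refine ha ?_
  rw [← cls_zero hI h0 n]
  exact cls_congr hI h0 n IsDiffFun.zero (hs α a.1 a.2 (by simpa using has))

theorem apply_spec (hD : IsDiffOp M I D) {Q : JetTuple p q} (hQ : IsDiffTuple M I Q) :
    IsDiffTuple M I (D.apply Q) ∧ clsTuple M hI h0 n (D.apply Q) =
      (diffJetAlgebra hM hI h0 n).opM (coef hI h0 n hD) (clsTuple M hI h0 n Q) := by
  obtain ⟨s, hs, hsupp⟩ := exists_support_coef hI h0 n hD
  have hmD := fun α J => multiD_spec hM hI h0 n (hQ α) J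
  have h := fun α => sum_finsum_spec (M := M) hI h0 n
    (G := fun β J z ε => D α β J z ε * multiD J (Q β) z ε)
    (fun β J => (hD.1 α β J).mul (hmD β J).1) (fun β J hJ => (hs α β J hJ).mul_zero_right)
  refine ⟨fun α => (h α).1, funext fun α => (h α).2.trans ?_⟩
  rw [JetAlgebra.opM, JetAlgebra.op_eq_sum _ _ _ (hsupp α)]
  refine Finset.sum_congr rfl fun β _ => Finset.sum_congr rfl fun J _ => ?_
  rw [coef_apply, clsTuple, ← (hmD β J).2]
  exact cls_mul hI h0 n (hD.1 α β J) (hmD β J).1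

theorem applyAdjoint_spec (hD : IsDiffOp M I D) {Q : JetTuple p q} (hQ : IsDiffTuple M I Q) :
    IsDiffTuple M I (D.applyAdjoint Q) ∧ clsTuple M hI h0 n (D.applyAdjoint Q) =
      (diffJetAlgebra hM hI h0 n).adjM (coef hI h0 n hD) (clsTuple M hI h0 n Q) := by
  obtain ⟨s, hs, hsupp⟩ := exists_support_coef hI h0 n hD
  have hmul : ∀ α β J, IsDiffFun M I fun w η => D β α J w η * Q β w η :=
    fun α β J => (hD.1 β α J).mul (hQ β)
  have hsD := fun α β J => sD_spec hM hI h0 n (hmul α β J) J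
  have h := fun α => sum_finsum_spec (M := M) hI h0 n (fun β J => (hsD α β J).1)
    (fun β J hJ => agree_sD_zero hM hI (hs β α J hJ).mul_zero_right J)
  refine ⟨fun α => (h α).1, funext fun α => (h α).2.trans ?_⟩
  rw [JetAlgebra.adjM]
  refine Finset.sum_congr rfl fun β _ => ?_
  rw [JetAlgebra.adj_eq_sum _ _ _ _ (hsupp β)]
  refine Finset.sum_congr rfl fun J _ => ?_
  rw [(hsD α β J).2, coef_apply, clsTuple]
  exact congrArg _ (cls_mul hI h0 n (hD.1 β α J) (hQ β))

theorem isDiffOp_frechet (hM : IsOpen M) (hI : IsOpen I) {K : JetTuple p q}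
    (hK : IsDiffTuple M I K) : IsDiffOp M I (frechet K) := by
  classical
  refine ⟨fun α β J => (hK α).partialU hM hI β J, ?_⟩
  choose s hs using fun α => (hK α).exists_partialU_eq_zero hM hI
  refine ⟨Finset.univ.biUnion s, fun α β J hJ => hs α β J fun h => hJ ?_⟩
  exact Finset.mem_biUnion.2 ⟨α, Finset.mem_univ α, h⟩

/-- The coefficients depend only on the class of K; hence `K ≈ D δH` is enough, though D_K involves
derivatives of K. -/
theorem coef_frechet {K : JetTuple p q} (hK : IsDiffTuple M I K) :
    coef hI h0 n (isDiffOp_frechet hM hI hK) =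
      fun α => (diffJetAlgebra hM hI h0 n).d (clsTuple M hI h0 n K α) := by
  funext α
  ext a
  exact (d_cls hM hI h0 n (hK α) a).symm

theorem isDiffOp_prolong (hM : IsOpen M) (hI : IsOpen I) (h0 : (0 : ℝ) ∈ I) (hD : IsDiffOp M I D)
    {Q : JetTuple p q} (hQ : IsDiffTuple M I Q) : IsDiffOp M I (D.prolong Q) := by
  obtain ⟨s, hs⟩ := hD.2
  -- The order 0 is arbitrary: being a differential function does not involve it.
  exact ⟨fun α β J => (prolong_spec hM hI h0 0 hQ (hD.1 α β J)).1, s,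
    fun α β J hJ => Agree.prolong hM hI Q (hs α β J hJ)⟩

theorem coef_prolong (hD : IsDiffOp M I D) {Q : JetTuple p q} (hQ : IsDiffTuple M I Q) :
    coef hI h0 n (isDiffOp_prolong hM hI h0 hD hQ) =
      (diffJetAlgebra hM hI h0 n).prM (clsTuple M hI h0 n Q) (coef hI h0 n hD) := by
  funext α
  ext a
  exact (prolong_spec hM hI h0 n hQ (hD.1 α a.1 a.2)).2

theorem bracket_spec (hD : IsDiffOp M I D) (hF : IsDiffFun M I F) (hG : IsDiffFun M I G) :
    IsDiffFun M I (bracket D F G) ∧ cls M hI h0 n (bracket D F G) =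
      (diffJetAlgebra hM hI h0 n).brk (coef hI h0 n hD) (cls M hI h0 n F)
        (cls M hI h0 n G) := by
  have hF' := fun α => (euler_spec hM hI h0 n hF α).1
  obtain ⟨hP, hP'⟩ := apply_spec hM hI h0 n hD fun α => (euler_spec hM hI h0 n hG α).1
  have hsum : bracket D F G = ∑ α, euler F α * D.apply (euler G) α := by
    funext z ε
    rw [Finset.sum_apply, Finset.sum_apply]
    rfl
  have hm := fun α => (hF' α).mul (hP α)
  rw [hsum]
  refine ⟨IsDiffFun.sum fun α _ => hm α, ?_⟩
  rw [cls_sum hI h0 n fun α _ => hm α, JetAlgebra.brk, ← clsTuple_euler hM hI h0 n hF,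
    ← clsTuple_euler hM hI h0 n hG, ← hP', dotProduct]
  exact Finset.sum_congr rfl fun α _ => cls_mul hI h0 n (hF' α) (hP α)

/-- Carries the skew-symmetry and Jacobi hypotheses over to exact identities in the quotient. -/
theorem int_cls_eq_zero (hF : IsDiffFun M I F) (h : FunctionalApproxZero M I n F) :
    (diffJetAlgebra hM hI h0 n).int (cls M hI h0 n F) = 0 := by
  obtain ⟨X, hX, hFX⟩ := h
  have hD := fun i => totalD_spec hM hI h0 n (hX i) i
  have hsum : totalDiv X = ∑ i, totalD i (X i) := by
    funext z ε
    rw [Finset.sum_apply, Finset.sum_apply]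
    rfl
  rw [hsum] at hFX
  rw [(cls_eq_iff hI h0 n hF (IsDiffFun.sum fun i _ => (hD i).1)).2 hFX,
    cls_sum hI h0 n fun i _ => (hD i).1, map_sum]
  exact Finset.sum_eq_zero fun i _ => by rw [(hD i).2, JetAlgebra.int_totD]

theorem IsApproxHamiltonian.int_skew (hD : IsApproxHamiltonian M I n D)
    (a b : DiffQuot M hI h0 n) :
    (diffJetAlgebra hM hI h0 n).int
      ((diffJetAlgebra hM hI h0 n).brk (coef hI h0 n hD.isDiffOp) a b +
        (diffJetAlgebra hM hI h0 n).brk (coef hI h0 n hD.isDiffOp) b a) = 0 := by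
  obtain ⟨F, hF, rfl⟩ := exists_cls_eq hI h0 n a
  obtain ⟨G, hG, rfl⟩ := exists_cls_eq hI h0 n b
  have h1 := bracket_spec hM hI h0 n hD.isDiffOp hF hG
  have h2 := bracket_spec hM hI h0 n hD.isDiffOp hG hF
  rw [← h1.2, ← h2.2, ← cls_add hI h0 n h1.1 h2.1]
  exact int_cls_eq_zero hM hI h0 n (h1.1.add h2.1) (hD.skew F G hF hG)

theorem IsApproxHamiltonian.int_jacobi (hD : IsApproxHamiltonian M I n D)
    (a b c : DiffQuot M hI h0 n) :
    let S := diffJetAlgebra hM hI h0 n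
    let P := coef hI h0 n hD.isDiffOp
    S.int (S.brk P (S.brk P a b) c + S.brk P (S.brk P b c) a + S.brk P (S.brk P c a) b) = 0 := by
  intro S P
  obtain ⟨F, hF, rfl⟩ := exists_cls_eq hI h0 n a
  obtain ⟨G, hG, rfl⟩ := exists_cls_eq hI h0 n b
  obtain ⟨H, hH, rfl⟩ := exists_cls_eq hI h0 n c
  have h : ∀ {F G H : JetFun p q}, IsDiffFun M I F → IsDiffFun M I G → IsDiffFun M I H →
      IsDiffFun M I (bracket D (bracket D F G) H) ∧ cls M hI h0 n (bracket D (bracket D F G) H) =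
        S.brk P (S.brk P (cls M hI h0 n F) (cls M hI h0 n G)) (cls M hI h0 n H) := by
    intro F G H hF hG hH
    have h1 := bracket_spec hM hI h0 n hD.isDiffOp hF hG
    have h2 := bracket_spec hM hI h0 n hD.isDiffOp h1.1 hH
    exact ⟨h2.1, by rw [h2.2, h1.2]⟩
  rw [← (h hF hG hH).2, ← (h hG hH hF).2, ← (h hH hF hG).2,
    ← cls_add hI h0 n (h hF hG hH).1 (h hG hH hF).1,
    ← cls_add hI h0 n ((h hF hG hH).1.add (h hG hH hF).1) (h hH hF hG).1]
  exact int_cls_eq_zero hM hI h0 n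
    (((h hF hG hH).1.add (h hG hH hF).1).add (h hH hF hG).1) (hD.jacobi F G H hF hG hH)

end ApproxHam

end

theorem mainTheorem7 {p q : ℕ} (n : ℕ) (M : Set ((Fin p → ℝ) × (Fin q → ℝ))) (hM : IsOpen M)
    (I : Set ℝ) (hI : IsOpen I) (h0 : (0 : ℝ) ∈ I)
    (D : ApproxHam.DiffOp p q) (hD : ApproxHam.IsApproxHamiltonian M I n D)
    (H : ApproxHam.JetFun p q) (hH : ApproxHam.IsDiffFun M I H)
    (K : ApproxHam.JetTuple p q) (hK : ApproxHam.IsDiffTuple M I K)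
    (hKH : ApproxHam.TupleApprox M n K (D.apply (ApproxHam.euler H))) :
    ApproxHam.OpApprox M I n
      (ApproxHam.DiffOp.prolong (D.apply (ApproxHam.euler H)) D).apply
      ((ApproxHam.frechet K).apply ∘ D.apply +
        D.apply ∘ (ApproxHam.frechet K).applyAdjoint) := by
  open ApproxHam in
  intro Q hQ α
  have hδ : IsDiffTuple M I (euler H) := fun α => (euler_spec hM hI h0 n hH α).1
  obtain ⟨hP, hP'⟩ := apply_spec hM hI h0 n hD.isDiffOp hδ
  have hKP : clsTuple M hI h0 n K = clsTuple M hI h0 n (D.apply (euler H)) :=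
    funext fun α => (cls_eq_iff hI h0 n (hK α) (hP α)).2 (hKH α)
  have hFr := isDiffOp_frechet hM hI hK
  obtain ⟨h1, h1'⟩ := apply_spec hM hI h0 n (isDiffOp_prolong hM hI h0 hD.isDiffOp hP) hQ
  obtain ⟨h2, h2'⟩ := apply_spec hM hI h0 n hD.isDiffOp hQ
  obtain ⟨h3, h3'⟩ := apply_spec hM hI h0 n hFr h2
  obtain ⟨h4, h4'⟩ := applyAdjoint_spec hM hI h0 n hFr hQ
  obtain ⟨h5, h5'⟩ := apply_spec hM hI h0 n hD.isDiffOp h4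
  rw [coef_prolong hM hI h0 n hD.isDiffOp hP] at h1'
  rw [coef_frechet hM hI h0 n hK] at h3' h4'
  refine (cls_eq_iff hI h0 n (h1 α) ((h3 α).add (h5 α))).1 ?_
  rw [cls_add hI h0 n (h3 α) (h5 α)]
  -- Every class has a representative, so the bracket identities hold for all elements of the
  -- quotient, as `prM_eq` requires.
  have key := JetAlgebra.prM_eq (hD.int_skew hM hI h0 n) (hD.int_jacobi hM hI h0 n)
    (cls M hI h0 n H) (hKP.trans (by rw [hP', clsTuple_euler hM hI h0 n hH]))
    (clsTuple M hI h0 n Q)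
  rw [hKP, ← h1', ← hKP, ← h2', ← h3', ← h4', ← h5'] at key
  exact congrFun key α
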